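/- **Setting.** Consider a periodic chain of $N$ sites with local Hilbert space $\mathbb C^d$; for a one-site operator $A$ write $A_j$ for $A$ acting on site $j\in\mathbb Z/N$. Let $\tilde G$ be a group with a unitary representation $u:\tilde G\to U(d)$, acting on the chain by $\hat U_g=u(g)^{\otimes N}$. Let $\mathfrak k$ be the real span of the Hermitian matrices $A$ with $e^{i\theta A}\in u(\tilde G)$ for all $\theta\in\mathbb R$ (the local generators), $\mathfrak t\subset\mathfrak k$ a maximal commuting subspace (Cartan subalgebra), and call $q\neq 0$ in the complex span of $\mathfrak k$ a root vector of the root $\alpha\neq0$, $\alpha:\mathfrak t\to\mathbb R$ linear, if $[t,q]=\alpha(t)q$ for all $t\in\mathfrak t$. Fix $z\in\mathfrak t$ on which no root vanishes; root vectors with $\alpha(z)>0$ (resp. $\alpha(z)<0$) are called raising (resp. lowering) operators. Let the anchor $\psi_e\in\mathbb C^d$ be a unit extremal-weight vector: a common eigenvector of $\mathfrak t$ annihilated by all lowering operators. Put $|\Psi_e\rangle=\psi_e^{\otimes N}$ and $\mathcal H_{\tilde G}=\operatorname{span}\{\hat U_g|\Psi_e\rangle: g\in\tilde G\}$. Let $\hat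 H=\hat H_N=\sum_{l\in\mathbb Z/N}\hat h_l$, where $\hat h_l$ is the translate to the sites $l,\dots,l+m$ of one fixed Hermitian operator on $m+1$ sites, not depending on $N$. Assume that for all $N\ge N_1$ the Hamiltonian is degenerate on the quasisymmetry subspace: $\hat H_N\Psi=E_0(N)\Psi$ for all $\Psi\in\mathcal H_{\tilde G}$. For raising operators $q_\alpha,q_\beta,\dots,q_\lambda$ (any finite number, repetitions allowed) let $\hat Q_a=\sum_j (q_a)_j$ and let $$|\Psi_{M}\rangle=\hat Q_\lambda\cdots\hat Q_\beta\hat Q_\alpha|\Psi_e\rangle$$ be the tower state with label $M=(q_\lambda,\dots,q_\beta,q_\alpha)$. Fix a raising operator $q^+$ and put $$|k,M\rangle=\sum_{j=0}^{N-1}e^{ikj}q^+_j|\Psi_M\rangle,\qquad k\in\tfrac{2\pi}{N}\mathbb Z,\ k\notin2\pi\mathbb Z .$$ Whenever $|k,M\rangle\ne0$, write $E$ for the expectation of $\hat H$ in the normalised state $|k,M\rangle$, and set $\varepsilon_{N,M}(k)=E-E_0(N)$ and $\delta\varepsilon^2_{N,M}(k)=\langle(\hat H-E)^2\rangle$. **Statement.**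 1. For every fixed label $M$ there are continuous functions $\varepsilon,v:\mathbb R\to\mathbb R$ with $\varepsilon(k)\to0$ and $v(k)\to0$ as $k\to0$, such that $\varepsilon_{N,M}(k)\to\varepsilon(k)$ and $\delta\varepsilon^2_{N,M}(k)\to v(k)$ as $N\to\infty$, uniformly over all $k\in\frac{2\pi}{N}\mathbb Z\setminus2\pi\mathbb Z$ with $|k,M\rangle\neq0$. 2. For tower states whose label may depend on the size (e.g. at finite filling), the same holds uniformly: for every $\eta>0$ there are $\delta>0$ and $N_0$ such that for all $N\ge N_0$ and all labels $M$ of any length, (a) $|\varepsilon_{N,M}(k)-\varepsilon_{N,M}(k')|<\eta$ and $|\delta\varepsilon^2_{N,M}(k)-\delta\varepsilon^2_{N,M}(k')|<\eta$ whenever $|k-k'|<\delta$, and (b) $|\varepsilon_{N,M}(k)|<\eta$ and $|\delta\varepsilon^2_{N,M}(k)|<\eta$ whenever $|k|<\delta$; here $k,k'$ range over $\frac{2\pi}{N}\mathbb Z\setminus2\pi\mathbb Z$ with $|k,M\rangle,|k',M\rangle\ne0$. -/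

import Mathlib

open scoped Matrix

/-! ## Periodic chain of `N` sites with local space `ℂ^d`

The sites are `ZMod N`; a basis configuration is a map `ZMod N → Fin d`; the many-body space
`(ℂ^d)^{⊗N}` is the space of complex functions on configurations, and many-body operators are
matrices indexed by configurations. -/

namespace ScarTower

/-- Basis configurations of the chain. -/
abbrev Config (d N : ℕ) : Type := ZMod N → Fin d

/-- Many-body state vectors. -/
abbrev State (d N : ℕ) : Type := Config d N → ℂ

/-- Many-body operators. -/
abbrev Op (d N : ℕ) : Type := Matrix (Config d N) (Config d N) ℂ

section Chain

variable {d : ℕ} (N : ℕ) [NeZero N]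

/-- The product state `ψ ⊗ ⋯ ⊗ ψ`. -/
noncomputable def productState (ψ : Fin d → ℂ) : State d N :=
  fun σ => ∏ j, ψ (σ j)

/-- The onsite global action `A ⊗ ⋯ ⊗ A`. -/
noncomputable def onsiteAction (A : Matrix (Fin d) (Fin d) ℂ) : Op d N :=
  fun σ τ => ∏ j, A (σ j) (τ j)

/-- The one-site operator `A` acting on site `j` (and as the identity elsewhere). -/
noncomputable def siteOp (A : Matrix (Fin d) (Fin d) ℂ) (j : ZMod N) : Op d N :=
  fun σ τ => if ∀ i, i ≠ j → σ i = τ i then A (σ j) (τ j) else 0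

/-- The block operator `h` acting on the sites `l, l + 1, …, l + m` (and as the identity
elsewhere).  It has this meaning when `m + 1 ≤ N`. -/
noncomputable def blockOp {m : ℕ}
    (h : Matrix (Fin (m + 1) → Fin d) (Fin (m + 1) → Fin d) ℂ) (l : ZMod N) : Op d N :=
  fun σ τ =>
    if ∀ i, (∀ a : Fin (m + 1), i ≠ l + ((a : ℕ) : ZMod N)) → σ i = τ i then
      h (fun a => σ (l + ((a : ℕ) : ZMod N))) (fun a => τ (l + ((a : ℕ) : ZMod N)))
    else 0

/-- The translation invariant local Hamiltonian `H = ∑ₗ hₗ` with periodic boundary conditions. -/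
noncomputable def hamiltonian {m : ℕ}
    (h : Matrix (Fin (m + 1) → Fin d) (Fin (m + 1) → Fin d) ℂ) : Op d N :=
  ∑ l, blockOp N h l

/-- The collective operator `Q = ∑ⱼ qⱼ`. -/
noncomputable def collectiveOp (q : Matrix (Fin d) (Fin d) ℂ) : Op d N :=
  ∑ j, siteOp N q j

/-- The twisted collective operator `Q_k = ∑ⱼ e^{ikj} qⱼ`, the sites being numbered
`0, …, N - 1`. -/
noncomputable def twistedOp (k : ℝ) (q : Matrix (Fin d) (Fin d) ℂ) : Op d N :=
  ∑ j : ZMod N, Complex.exp (Complex.I * k * (j.val : ℂ)) • siteOp N q j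

/-- For a list `[q_λ, …, q_β, q_α]`, the tower state `Q_λ ⋯ Q_β Q_α (ψ ⊗ ⋯ ⊗ ψ)`. -/
noncomputable def towerState (ψ : Fin d → ℂ) (w : List (Matrix (Fin d) (Fin d) ℂ)) : State d N :=
  w.foldr (fun q Ψ => collectiveOp N q *ᵥ Ψ) (productState N ψ)

/-- The twisted tower state `|k, M⟩ = ∑ⱼ e^{ikj} qⱼ |Ψ_M⟩` (not normalised). -/
noncomputable def twistedState (ψ : Fin d → ℂ) (w : List (Matrix (Fin d) (Fin d) ℂ))
    (q : Matrix (Fin d) (Fin d) ℂ) (k : ℝ) : State d N :=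
  twistedOp N k q *ᵥ towerState N ψ w

/-- The expectation `⟨Ψ|A|Ψ⟩ / ⟨Ψ|Ψ⟩` in the normalised state (used for `Ψ ≠ 0` only). -/
noncomputable def expectation (A : Op d N) (Ψ : State d N) : ℂ :=
  (star Ψ ⬝ᵥ (A *ᵥ Ψ)) / (star Ψ ⬝ᵥ Ψ)

/-- The energy expectation; it is real for a Hermitian `H`. -/
noncomputable def energy (H : Op d N) (Ψ : State d N) : ℝ :=
  (expectation N H Ψ).re

/-- The energy variance `⟨(H - ⟨H⟩)²⟩`. -/
noncomputable def energyVariance (H : Op d N) (Ψ : State d N) : ℝ :=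
  (expectation N ((H - (energy N H Ψ : ℂ) • (1 : Op d N)) ^ 2) Ψ).re

end Chain

/-! ## Quasisymmetry -/

section Quasisymmetry

variable {d : ℕ} {G : Type*} [Group G] (u : G →* Matrix.unitaryGroup (Fin d) ℂ)

/-- The quasisymmetry subspace, spanned by the states `U_g |Ψ_e⟩ = u(g)^{⊗N} ψ^{⊗N}`. -/
noncomputable def scarSpace (ψ : Fin d → ℂ) (N : ℕ) [NeZero N] : Submodule ℂ (State d N) :=
  Submodule.span ℂ (Set.range fun g : G =>
    onsiteAction N (u g : Matrix (Fin d) (Fin d) ℂ) *ᵥ productState N ψ)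

/-- The real space of local (Hermitian) generators: the span of the Hermitian `A` whose
one-parameter group `θ ↦ e^{iθA}` lies in the image of the group. -/
noncomputable def generatorSpace : Submodule ℝ (Matrix (Fin d) (Fin d) ℂ) :=
  Submodule.span ℝ {A | A.IsHermitian ∧
    ∀ θ : ℝ, ∃ g : G, (u g : Matrix (Fin d) (Fin d) ℂ)
      = NormedSpace.exp ((Complex.I * (θ : ℂ)) • A)}

/-- The complexified Lie algebra, in which the ladder operators live. -/
noncomputable def complexGenerators : Submodule ℂ (Matrix (Fin d) (Fin d) ℂ) :=
  Submodule.span ℂ (generatorSpace u : Set (Matrix (Fin d) (Fin d) ℂ))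

/-- `T` is a Cartan subalgebra: a maximal space of mutually commuting generators. -/
structure IsCartan (T : Submodule ℝ (Matrix (Fin d) (Fin d) ℂ)) : Prop where
  le : T ≤ generatorSpace u
  comm : ∀ s ∈ T, ∀ t ∈ T, s * t = t * s
  maximal : ∀ a ∈ generatorSpace u, (∀ t ∈ T, a * t = t * a) → a ∈ T

/-- `q` is a root vector of root `α ≠ 0`: `[t, q] = α(t) q` for all `t` in the Cartan
subalgebra. -/
structure IsRootVector (T : Submodule ℝ (Matrix (Fin d) (Fin d) ℂ)) (α : T →ₗ[ℝ] ℝ)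
    (q : Matrix (Fin d) (Fin d) ℂ) : Prop where
  mem : q ∈ complexGenerators u
  ne_zero : q ≠ 0
  root_ne_zero : α ≠ 0
  bracket : ∀ t : T, (t : Matrix (Fin d) (Fin d) ℂ) * q - q * t = (α t : ℂ) • q

/-- `z` in the Cartan subalgebra is regular (no root vanishes on it), so that its sign on the
roots splits them into positive and negative ones. -/
def IsRegular (T : Submodule ℝ (Matrix (Fin d) (Fin d) ℂ)) (z : T) : Prop :=
  ∀ (α : T →ₗ[ℝ] ℝ) (q : Matrix (Fin d) (Fin d) ℂ), IsRootVector u T α q → α z ≠ 0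

/-- The ladder operators `q⁺`: root vectors of positive roots. -/
def IsRaising (T : Submodule ℝ (Matrix (Fin d) (Fin d) ℂ)) (z : T)
    (q : Matrix (Fin d) (Fin d) ℂ) : Prop :=
  ∃ α : T →ₗ[ℝ] ℝ, IsRootVector u T α q ∧ 0 < α z

/-- The ladder operators `q⁻`: root vectors of negative roots. -/
def IsLowering (T : Submodule ℝ (Matrix (Fin d) (Fin d) ℂ)) (z : T)
    (q : Matrix (Fin d) (Fin d) ℂ) : Prop :=
  ∃ α : T →ₗ[ℝ] ℝ, IsRootVector u T α q ∧ α z < 0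

/-- The local anchor state: a unit extremal-weight vector, i.e. a common eigenvector of the Cartan
subalgebra that all lowering operators annihilate (the all-down convention, in which the tower is
built by raising operators). -/
structure IsAnchor (T : Submodule ℝ (Matrix (Fin d) (Fin d) ℂ)) (z : T) (ψ : Fin d → ℂ) :
    Prop where
  normalized : star ψ ⬝ᵥ ψ = 1
  weight : ∀ t ∈ T, ∃ μ : ℂ, t *ᵥ ψ = μ • ψ
  extremal : ∀ q, IsLowering u T z q → q *ᵥ ψ = 0

end Quasisymmetry

end ScarTower

/-!
Subtract from the local term its value on the anchor, so that the Hamiltonian `H = ∑ₗ hₗ` kills the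
scar space. The collective operator `Q` preserves the scar space and the phases `e^{ikj}` sum to
zero, so `∑ⱼ e^{ikj} qⱼ Ψ = ∑ⱼ e^{ikj} Dⱼ` with `Dⱼ = (qⱼ - qᵣ) Ψ` for any site `r`. For an operator
`X` on a window `W` that vanishes between scar states, and `r` outside `W`, only the sites of `W`
contribute to the matrix element of `X`, which is therefore the trigonometric sum `∑ e^{ik(j - i)}
⟨Dᵢ, X Dⱼ⟩` over `i, j ∈ W`. Its coefficients add up to zero, since `Q Ψ` is again a scar state;
hence every phase may be replaced by `e^{ik(j - i)} - 1`, which is small for small `k`. By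
permutation symmetry `⟨Dᵢ, Dᵢ⟩` does not depend on `i ≠ r` and is half the squared norm per site of
the twisted state, so the normalised coefficients are bounded by a multiple of `‖X‖`, uniformly in
the size and in the tower state; for a fixed label they converge because matrix elements between
tower states are polynomials in `N`.

For the energy take `X = hₗ`. For the variance, `H²` couples pairs of blocks. The pairs of disjoint
blocks have equivalent matrix elements by permutation symmetry, so `∑ₜ e^{ikt} = 0` trades the sum
over all distant pairs for a sum over pairs at bounded distance.
-/

namespace ScarTower

section Braket

variable {n : Type*} [Fintype n]

/-- The matrix element `⟨Φ|X|Φ'⟩`, bundled as a map that is antilinear in `Φ` and linear in `X`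
and `Φ'`. -/
noncomputable def braket : (n → ℂ) →ₗ⋆[ℂ] Matrix n n ℂ →ₗ[ℂ] (n → ℂ) →ₗ[ℂ] ℂ where
  toFun Φ := (Matrix.mulVecBilin ℂ ℂ).compr₂ (dotProductBilin ℂ ℂ (star Φ))
  map_add' _ _ := by ext; simp
  map_smul' _ _ := by ext; simp

theorem braket_apply (Φ : n → ℂ) (X : Matrix n n ℂ) (Φ' : n → ℂ) :
    braket Φ X Φ' = star Φ ⬝ᵥ (X *ᵥ Φ') := rfl

theorem braket_mul (Φ : n → ℂ) (X Y : Matrix n n ℂ) (Φ' : n → ℂ) :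
    braket Φ (X * Y) Φ' = braket Φ X (Y *ᵥ Φ') := by
  simp only [braket_apply, Matrix.mulVec_mulVec]

theorem braket_mulVec_left (Φ : n → ℂ) (X Y : Matrix n n ℂ) (Φ' : n → ℂ) :
    braket (Y *ᵥ Φ) X Φ' = braket Φ (Yᴴ * X) Φ' := by
  simp only [braket_apply, Matrix.star_mulVec, ← Matrix.mulVec_mulVec,
    Matrix.dotProduct_mulVec _ Yᴴ]

theorem braket_one [DecidableEq n] (Φ Φ' : n → ℂ) : braket Φ 1 Φ' = star Φ ⬝ᵥ Φ' := by
  simp only [braket_apply, Matrix.one_mulVec]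

theorem braket_eq_zero_of_mem_span {S S' : Set (n → ℂ)} {X : Matrix n n ℂ}
    (h : ∀ Φ ∈ S, ∀ Φ' ∈ S', braket Φ X Φ' = 0) {Φ Φ' : n → ℂ}
    (hΦ : Φ ∈ Submodule.span ℂ S) (hΦ' : Φ' ∈ Submodule.span ℂ S') : braket Φ X Φ' = 0 := by
  have right : ∀ Φ ∈ S, Submodule.span ℂ S' ≤ LinearMap.ker (braket Φ X) := fun Φ hΦ =>
    Submodule.span_le.mpr (h Φ hΦ)
  have left : Submodule.span ℂ S ≤ LinearMap.ker ((braket.flip X).flip Φ') :=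
    Submodule.span_le.mpr fun Φ hΦ => right Φ hΦ hΦ'
  exact left hΦ

end Braket

section Tensor

variable {d N : ℕ} [NeZero N]

/-- The product state `⨂ⱼ aⱼ`. -/
noncomputable def tensorState (a : ZMod N → Fin d → ℂ) : State d N :=
  fun σ => ∏ j, a j (σ j)

/-- The product operator `⨂ⱼ Aⱼ`, as a monoid homomorphism. -/
noncomputable def tensorOp : (ZMod N → Matrix (Fin d) (Fin d) ℂ) →* Op d N where
  toFun A := fun σ τ => ∏ j, A j (σ j) (τ j)
  map_one' := by
    ext σ τ
    simp only [Pi.one_apply, Matrix.one_apply, Finset.prod_ite_zero, Finset.mem_univ,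
      true_imp_iff, Finset.prod_const_one, funext_iff]
  map_mul' A B := by
    ext σ τ
    change ∏ j, (A j * B j) (σ j) (τ j)
      = ∑ ρ : Config d N, (∏ j, A j (σ j) (ρ j)) * ∏ j, B j (ρ j) (τ j)
    simp only [Matrix.mul_apply, Finset.prod_univ_sum, Fintype.piFinset_univ,
      Finset.prod_mul_distrib]

theorem tensorOp_apply (A : ZMod N → Matrix (Fin d) (Fin d) ℂ) (σ τ : Config d N) :
    tensorOp A σ τ = ∏ j, A j (σ j) (τ j) := rfl

theorem tensorOp_conjTranspose (A : ZMod N → Matrix (Fin d) (Fin d) ℂ) :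
    (tensorOp A)ᴴ = tensorOp fun j => (A j)ᴴ := by
  ext σ τ
  simp only [Matrix.conjTranspose_apply, tensorOp_apply, star_prod]

theorem tensorOp_mulVec_tensorState (A : ZMod N → Matrix (Fin d) (Fin d) ℂ)
    (b : ZMod N → Fin d → ℂ) :
    tensorOp A *ᵥ tensorState b = tensorState fun j => A j *ᵥ b j := by
  ext σ
  simp only [Matrix.mulVec, dotProduct, tensorOp_apply, tensorState, Finset.prod_univ_sum,
    Fintype.piFinset_univ, Finset.prod_mul_distrib]

theorem star_tensorState_dotProduct (a b : ZMod N → Fin d → ℂ) :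
    star (tensorState a) ⬝ᵥ tensorState b = ∏ j, (star (a j) ⬝ᵥ b j) := by
  simp only [dotProduct, tensorState, Pi.star_apply, star_prod, ← Finset.prod_mul_distrib,
    Finset.prod_univ_sum, Fintype.piFinset_univ]

theorem braket_tensorState_tensorOp (a b : ZMod N → Fin d → ℂ)
    (A : ZMod N → Matrix (Fin d) (Fin d) ℂ) :
    braket (tensorState a) (tensorOp A) (tensorState b) = ∏ j, (star (a j) ⬝ᵥ (A j *ᵥ b j)) := by
  rw [braket_apply, tensorOp_mulVec_tensorState, star_tensorState_dotProduct]

theorem commute_tensorOp {A B : ZMod N → Matrix (Fin d) (Fin d) ℂ}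
    (h : ∀ j, A j = 1 ∨ B j = 1) : Commute (tensorOp A) (tensorOp B) := by
  refine Commute.map (f := tensorOp) (funext fun j => ?_)
  rcases h j with hj | hj <;> simp [hj]

theorem siteOp_eq_tensorOp (A : Matrix (Fin d) (Fin d) ℂ) (j : ZMod N) :
    siteOp N A j = tensorOp (Pi.mulSingle j A) := by
  ext σ τ
  rw [siteOp, tensorOp_apply, ← Finset.mul_prod_erase _ _ (Finset.mem_univ j),
    Pi.mulSingle_eq_same, Finset.prod_congr rfl (g := fun i => if σ i = τ i then (1 : ℂ) else 0)]
  · rw [Finset.prod_ite_zero]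
    simp
  · intro i hi
    rw [Pi.mulSingle_eq_of_ne (Finset.ne_of_mem_erase hi), Matrix.one_apply]

theorem siteOp_mulVec_tensorState (A : Matrix (Fin d) (Fin d) ℂ) (j : ZMod N)
    (b : ZMod N → Fin d → ℂ) :
    siteOp N A j *ᵥ tensorState b = tensorState (Function.update b j (A *ᵥ b j)) := by
  rw [siteOp_eq_tensorOp, tensorOp_mulVec_tensorState]
  congr 1
  ext i : 1
  rcases eq_or_ne i j with rfl | hi <;> simp [*]

theorem siteOp_conjTranspose (A : Matrix (Fin d) (Fin d) ℂ) (j : ZMod N) :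
    (siteOp N A j)ᴴ = siteOp N Aᴴ j := by
  rw [siteOp_eq_tensorOp, siteOp_eq_tensorOp, tensorOp_conjTranspose]
  congr 1
  ext i : 1
  rcases eq_or_ne i j with rfl | hi <;> simp [*]

theorem siteOp_add (A B : Matrix (Fin d) (Fin d) ℂ) (j : ZMod N) :
    siteOp N (A + B) j = siteOp N A j + siteOp N B j := by
  ext σ τ
  simp only [siteOp, Matrix.add_apply]
  split_ifs <;> simp

theorem siteOp_smul (c : ℂ) (A : Matrix (Fin d) (Fin d) ℂ) (j : ZMod N) :
    siteOp N (c • A) j = c • siteOp N A j := by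
  ext σ τ
  simp only [siteOp, Matrix.smul_apply]
  split_ifs <;> simp

theorem collectiveOp_add (A B : Matrix (Fin d) (Fin d) ℂ) :
    collectiveOp N (A + B) = collectiveOp N A + collectiveOp N B := by
  simp only [collectiveOp, siteOp_add, Finset.sum_add_distrib]

theorem collectiveOp_smul (c : ℂ) (A : Matrix (Fin d) (Fin d) ℂ) :
    collectiveOp N (c • A) = c • collectiveOp N A := by
  simp only [collectiveOp, siteOp_smul, Finset.smul_sum]

theorem collectiveOp_zero : collectiveOp N (0 : Matrix (Fin d) (Fin d) ℂ) = 0 := by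
  simpa using collectiveOp_smul (N := N) 0 (0 : Matrix (Fin d) (Fin d) ℂ)

theorem collectiveOp_conjTranspose (A : Matrix (Fin d) (Fin d) ℂ) :
    (collectiveOp N A)ᴴ = collectiveOp N Aᴴ := by
  simp only [collectiveOp, siteOp_conjTranspose, Matrix.conjTranspose_sum]

end Tensor

section PlacedOp

variable {d N : ℕ} [NeZero N] {ι : Type*} [Fintype ι]

/-- For injective `f`, the operator `h` acting on the sites `f a` and as the identity elsewhere,
as a linear map in `h`. For the sites `l, …, l + m` this is `blockOp`. -/
noncomputable def placedOp (f : ι → ZMod N) :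
    Matrix (ι → Fin d) (ι → Fin d) ℂ →ₗ[ℂ] Op d N where
  toFun h := Matrix.of fun σ τ =>
    if ∀ i, (∀ a, i ≠ f a) → σ i = τ i then h (σ ∘ f) (τ ∘ f) else 0
  map_add' h h' := by
    ext σ τ
    simp only [Matrix.of_apply, Matrix.add_apply]
    split_ifs <;> simp
  map_smul' c h := by
    ext σ τ
    simp only [Matrix.of_apply, Matrix.smul_apply, RingHom.id_apply]
    split_ifs <;> simp

theorem placedOp_apply (f : ι → ZMod N) (h : Matrix (ι → Fin d) (ι → Fin d) ℂ)
    (σ τ : Config d N) :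
    placedOp f h σ τ =
      if ∀ i, (∀ a, i ≠ f a) → σ i = τ i then h (σ ∘ f) (τ ∘ f) else 0 := rfl

theorem blockOp_eq_placedOp {m : ℕ}
    (h : Matrix (Fin (m + 1) → Fin d) (Fin (m + 1) → Fin d) ℂ) (l : ZMod N) :
    blockOp N h l = placedOp (fun a : Fin (m + 1) => l + ((a : ℕ) : ZMod N)) h := by
  ext σ τ
  rw [placedOp_apply, blockOp]
  congr

theorem placedOp_one (f : ι → ZMod N) : placedOp f 1 = (1 : Op d N) := by
  ext σ τ
  have agree : ((∀ i, (∀ a, i ≠ f a) → σ i = τ i) ∧ σ ∘ f = τ ∘ f) ↔ σ = τ := by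
    refine ⟨fun ⟨hoff, hon⟩ => funext fun i => ?_, by rintro rfl; simp⟩
    by_cases hi : ∀ a, i ≠ f a
    · exact hoff i hi
    · push Not at hi
      obtain ⟨a, rfl⟩ := hi
      exact congrFun hon a
  simp only [placedOp_apply, Matrix.one_apply, ← ite_and, agree]

theorem placedOp_single {f : ι → ZMod N} (hf : Function.Injective f) (s t : ι → Fin d) :
    placedOp f (Matrix.single s t 1) =
      tensorOp (Function.extend f (fun a => Matrix.single (s a) (t a) 1) 1) := by
  ext σ τ
  have entry : ∀ j, Function.extend f (fun a => Matrix.single (s a) (t a) (1 : ℂ)) 1 j (σ j) (τ j)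
      = if ((∀ a, j ≠ f a) → σ j = τ j) ∧ ∀ a, j = f a → s a = σ j ∧ t a = τ j
        then 1 else 0 := by
    intro j
    by_cases hj : ∃ a, f a = j
    · obtain ⟨a, rfl⟩ := hj
      rw [hf.extend_apply, Matrix.single_apply]
      congr 1
      simp only [hf.eq_iff, forall_eq', eq_iff_iff, iff_and_self]
      exact fun _ h => absurd rfl (h a)
    · rw [Function.extend_apply' _ _ _ hj, Pi.one_apply, Matrix.one_apply]
      congr 1
      simp only [eq_iff_iff]
      push Not at hj
      exact ⟨fun h => ⟨fun _ => h, fun a ha => absurd ha.symm (hj a)⟩,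
        fun h => h.1 fun a ha => hj a ha.symm⟩
  simp only [placedOp_apply, tensorOp_apply, entry, Finset.prod_ite_zero, Finset.prod_const_one,
    Matrix.single_apply, ← ite_and]
  congr 1
  simp only [Finset.mem_univ, true_imp_iff, forall_and, eq_iff_iff, funext_iff,
    Function.comp_apply]
  aesop

theorem placedOp_eq_sum_tensorOp [DecidableEq ι] {f : ι → ZMod N} (hf : Function.Injective f)
    (h : Matrix (ι → Fin d) (ι → Fin d) ℂ) :
    placedOp f h = ∑ s, ∑ t,
      h s t • tensorOp (Function.extend f (fun a => Matrix.single (s a) (t a) 1) 1) := by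
  conv_lhs => rw [Matrix.matrix_eq_sum_single h]
  simp only [map_sum, ← placedOp_single hf, ← map_smul, Matrix.smul_single, smul_eq_mul, mul_one]

end PlacedOp

section Perm

variable {d N : ℕ} [NeZero N]

/-- The relabelling of states by a permutation of the sites, which moves the factor at `j` to
`π j`. -/
def permState (π : Equiv.Perm (ZMod N)) : State d N ≃ₗ[ℂ] State d N :=
  LinearEquiv.funCongrLeft ℂ ℂ (Equiv.arrowCongr π.symm (Equiv.refl (Fin d)))

/-- The conjugation of operators by the relabelling `permState π`. -/
def permOp (π : Equiv.Perm (ZMod N)) : Op d N ≃ₐ[ℂ] Op d N :=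
  Matrix.reindexAlgEquiv ℂ ℂ (Equiv.arrowCongr π (Equiv.refl (Fin d)))

omit [NeZero N] in
theorem permState_apply (π : Equiv.Perm (ZMod N)) (Φ : State d N) (σ : Config d N) :
    permState π Φ σ = Φ (σ ∘ π) := rfl

theorem permOp_apply (π : Equiv.Perm (ZMod N)) (X : Op d N) (σ τ : Config d N) :
    permOp π X σ τ = X (σ ∘ π) (τ ∘ π) := rfl

theorem permState_mulVec (π : Equiv.Perm (ZMod N)) (X : Op d N) (Φ : State d N) :
    permState π (X *ᵥ Φ) = permOp π X *ᵥ permState π Φ := by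
  ext σ
  exact ((Equiv.arrowCongr π.symm (Equiv.refl (Fin d))).sum_comp
    fun τ => X (σ ∘ π) τ * Φ τ).symm

theorem braket_permState (π : Equiv.Perm (ZMod N)) (Φ : State d N) (X : Op d N)
    (Φ' : State d N) :
    braket (permState π Φ) (permOp π X) (permState π Φ') = braket Φ X Φ' := by
  rw [braket_apply, ← permState_mulVec, braket_apply]
  exact (Equiv.arrowCongr π.symm (Equiv.refl (Fin d))).sum_comp fun σ => star Φ σ * (X *ᵥ Φ') σ

theorem permState_tensorState (π : Equiv.Perm (ZMod N)) (a : ZMod N → Fin d → ℂ) :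
    permState π (tensorState a) = tensorState (a ∘ π.symm) := by
  ext σ
  rw [permState_apply, tensorState, tensorState,
    ← Equiv.prod_comp π fun j => (a ∘ π.symm) j (σ j)]
  simp

theorem permOp_tensorOp (π : Equiv.Perm (ZMod N)) (A : ZMod N → Matrix (Fin d) (Fin d) ℂ) :
    permOp π (tensorOp A) = tensorOp (A ∘ π.symm) := by
  ext σ τ
  rw [permOp_apply, tensorOp_apply, tensorOp_apply,
    ← Equiv.prod_comp π fun j => (A ∘ π.symm) j (σ j) (τ j)]
  simp

theorem permOp_siteOp (π : Equiv.Perm (ZMod N)) (A : Matrix (Fin d) (Fin d) ℂ) (j : ZMod N) :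
    permOp π (siteOp N A j) = siteOp N A (π j) := by
  rw [siteOp_eq_tensorOp, siteOp_eq_tensorOp, permOp_tensorOp]
  congr 1
  ext i : 1
  rcases eq_or_ne i (π j) with rfl | hi
  · simp
  · simp [hi, Equiv.symm_apply_eq]

theorem permOp_collectiveOp (π : Equiv.Perm (ZMod N)) (A : Matrix (Fin d) (Fin d) ℂ) :
    permOp π (collectiveOp N A) = collectiveOp N A := by
  simp only [collectiveOp, map_sum, permOp_siteOp]
  exact Equiv.sum_comp π (siteOp N A)

theorem permOp_placedOp {ι : Type*} [Fintype ι] (π : Equiv.Perm (ZMod N)) (f : ι → ZMod N)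
    (h : Matrix (ι → Fin d) (ι → Fin d) ℂ) : permOp π (placedOp f h) = placedOp (π ∘ f) h := by
  ext σ τ
  have agree : (∀ i, (∀ a, i ≠ f a) → (σ ∘ π) i = (τ ∘ π) i) ↔
      ∀ i, (∀ a, i ≠ (π ∘ f) a) → σ i = τ i := by
    rw [← π.forall_congr_right (q := fun i => (∀ a, i ≠ (π ∘ f) a) → σ i = τ i)]
    simp
  exact if_congr agree rfl rfl

theorem permOp_addRight_blockOp {m : ℕ}
    (h : Matrix (Fin (m + 1) → Fin d) (Fin (m + 1) → Fin d) ℂ) (l t : ZMod N) :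
    permOp (Equiv.addRight t) (blockOp N h l) = blockOp N h (l + t) := by
  rw [blockOp_eq_placedOp, blockOp_eq_placedOp, permOp_placedOp]
  exact congrArg (placedOp · h) (funext fun a => add_right_comm l _ t)

theorem permOp_addRight_hamiltonian {m : ℕ}
    (h : Matrix (Fin (m + 1) → Fin d) (Fin (m + 1) → Fin d) ℂ) (t : ZMod N) :
    permOp (Equiv.addRight t) (hamiltonian N h) = hamiltonian N h := by
  simp only [hamiltonian, map_sum, permOp_addRight_blockOp]
  exact Equiv.sum_comp (Equiv.addRight t) (blockOp N h)

/-- Invariance of a state under all permutations of the sites. -/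
def IsSymm (Ψ : State d N) : Prop := ∀ π, permState π Ψ = Ψ

theorem isSymm_tensorState_const (φ : Fin d → ℂ) : IsSymm (tensorState fun _ : ZMod N => φ) :=
  fun π => permState_tensorState π _

theorem IsSymm.braket_permOp {Ψ Ψ' : State d N} (hΨ : IsSymm Ψ) (hΨ' : IsSymm Ψ')
    (π : Equiv.Perm (ZMod N)) (X : Op d N) : braket Ψ (permOp π X) Ψ' = braket Ψ X Ψ' := by
  rw [← braket_permState π Ψ X, hΨ π, hΨ' π]

end Perm

section Local

variable {d N : ℕ} [NeZero N]

/-- The algebra of the operators that act as the identity off the sites `W`. -/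
noncomputable def localAlgebra (d : ℕ) (W : Finset (ZMod N)) : Subalgebra ℂ (Op d N) :=
  Algebra.adjoin ℂ (tensorOp '' {A | ∀ j ∉ W, A j = 1})

variable {W : Finset (ZMod N)}

theorem localAlgebra_mono {W' : Finset (ZMod N)} (hW : W ⊆ W') :
    localAlgebra d W ≤ localAlgebra d W' :=
  Algebra.adjoin_mono <| Set.image_mono fun _ hA j hj => hA j fun hjW => hj (hW hjW)

theorem tensorOp_mem_localAlgebra {A : ZMod N → Matrix (Fin d) (Fin d) ℂ}
    (hA : ∀ j ∉ W, A j = 1) : tensorOp A ∈ localAlgebra d W :=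
  Algebra.subset_adjoin ⟨A, hA, rfl⟩

theorem siteOp_mem_localAlgebra (A : Matrix (Fin d) (Fin d) ℂ) {j : ZMod N} (hj : j ∈ W) :
    siteOp N A j ∈ localAlgebra d W := by
  rw [siteOp_eq_tensorOp]
  exact tensorOp_mem_localAlgebra fun i hi =>
    Pi.mulSingle_eq_of_ne (ne_of_mem_of_not_mem hj hi).symm _

theorem placedOp_mem_localAlgebra {ι : Type*} [Fintype ι] {f : ι → ZMod N}
    (hf : Function.Injective f) (hW : ∀ a, f a ∈ W) (h : Matrix (ι → Fin d) (ι → Fin d) ℂ) :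
    placedOp f h ∈ localAlgebra d W := by
  classical
  rw [placedOp_eq_sum_tensorOp hf]
  refine sum_mem fun s _ => sum_mem fun t _ => Subalgebra.smul_mem _ ?_ _
  refine tensorOp_mem_localAlgebra fun j hj => Function.extend_apply' _ _ _ ?_
  rintro ⟨a, rfl⟩
  exact hj (hW a)

theorem toSubmodule_localAlgebra (W : Finset (ZMod N)) :
    (localAlgebra d W).toSubmodule = Submodule.span ℂ (tensorOp '' {A | ∀ j ∉ W, A j = 1}) := by
  have image_eq : tensorOp '' {A | ∀ j ∉ W, A j = 1} =
      ((Submonoid.pi (Wᶜ : Set (ZMod N)) fun _ => ⊥).map (tensorOp (d := d)) : Set (Op d N)) := by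
    ext X
    simp [Submonoid.mem_pi]
  rw [localAlgebra, Algebra.adjoin_eq_span, image_eq, Submonoid.closure_eq]

theorem commute_of_mem_localAlgebra {W' : Finset (ZMod N)} (hW : Disjoint W W') {X Y : Op d N}
    (hX : X ∈ localAlgebra d W) (hY : Y ∈ localAlgebra d W') : Commute X Y := by
  refine Algebra.commute_of_mem_adjoin_of_forall_mem_commute hY ?_
  rintro _ ⟨B, hB, rfl⟩
  refine (Algebra.commute_of_mem_adjoin_of_forall_mem_commute hX ?_).symm
  rintro _ ⟨A, hA, rfl⟩
  refine commute_tensorOp fun j => ?_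
  by_cases hj : j ∈ W
  · exact .inl (hB j (Finset.disjoint_left.mp hW hj))
  · exact .inr (hA j hj)

theorem permOp_eq_self_of_mem_localAlgebra {π : Equiv.Perm (ZMod N)} (hπ : ∀ j ∈ W, π j = j)
    {X : Op d N} (hX : X ∈ localAlgebra d W) : permOp π X = X := by
  have le : localAlgebra d W ≤ AlgHom.equalizer (permOp π).toAlgHom (.id ℂ _) := by
    refine Algebra.adjoin_le ?_
    rintro _ ⟨A, hA, rfl⟩
    refine (permOp_tensorOp π A).trans (congrArg tensorOp (funext fun j => ?_))
    by_cases hj : j ∈ W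
    · rw [Function.comp_apply, π.symm_apply_eq.mpr (hπ j hj).symm]
    · have hj' : π.symm j ∉ W := fun h => hj (by rwa [← hπ _ h, π.apply_symm_apply] at h)
      rw [Function.comp_apply, hA _ hj, hA _ hj']
  exact le hX

theorem exists_braket_tensorState_eq {X : Op d N} (hX : X ∈ localAlgebra d W)
    (a b : ZMod N → Fin d → ℂ) :
    ∃ c, ∀ a' b' : ZMod N → Fin d → ℂ, (∀ j ∈ W, a' j = a j) → (∀ j ∈ W, b' j = b j) →
      braket (tensorState a') X (tensorState b') = c * ∏ j ∈ Wᶜ, (star (a' j) ⬝ᵥ b' j) := by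
  rw [← Subalgebra.mem_toSubmodule, toSubmodule_localAlgebra] at hX
  induction hX using Submodule.span_induction with
  | zero => exact ⟨0, by simp⟩
  | add X Y _ _ hX hY =>
    obtain ⟨c, hc⟩ := hX
    obtain ⟨c', hc'⟩ := hY
    refine ⟨c + c', fun a' b' ha hb => ?_⟩
    rw [map_add, LinearMap.add_apply, hc a' b' ha hb, hc' a' b' ha hb, add_mul]
  | smul z X _ hX =>
    obtain ⟨c, hc⟩ := hX
    refine ⟨z * c, fun a' b' ha hb => ?_⟩
    rw [map_smul, LinearMap.smul_apply, hc a' b' ha hb, smul_eq_mul, mul_assoc]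
  | mem X hX =>
    obtain ⟨A, hA, rfl⟩ := hX
    refine ⟨∏ j ∈ W, (star (a j) ⬝ᵥ (A j *ᵥ b j)), fun a' b' ha hb => ?_⟩
    rw [braket_tensorState_tensorOp, ← Finset.prod_mul_prod_compl W]
    congr 1
    · exact Finset.prod_congr rfl fun j hj => by rw [ha j hj, hb j hj]
    · refine Finset.prod_congr rfl fun j hj => ?_
      rw [hA j (Finset.mem_compl.mp hj), Matrix.one_mulVec]

theorem braket_tensorState_eq_zero_of_orthogonal {X : Op d N} (hX : X ∈ localAlgebra d W)
    {a b : ZMod N → Fin d → ℂ} {j : ZMod N} (hj : j ∉ W) (hab : star (a j) ⬝ᵥ b j = 0) :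
    braket (tensorState a) X (tensorState b) = 0 := by
  obtain ⟨c, hc⟩ := exists_braket_tensorState_eq hX a b
  rw [hc a b (fun _ _ => rfl) fun _ _ => rfl,
    Finset.prod_eq_zero (Finset.mem_compl.mpr hj) hab, mul_zero]

theorem braket_tensorState_eq_zero_of_agree {X : Op d N} (hX : X ∈ localAlgebra d W)
    {a b a' b' : ZMod N → Fin d → ℂ} (ha : ∀ j ∈ W, a' j = a j) (hb : ∀ j ∈ W, b' j = b j)
    (hab : ∀ j ∉ W, star (a' j) ⬝ᵥ b' j ≠ 0)
    (h : braket (tensorState a') X (tensorState b') = 0) :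
    braket (tensorState a) X (tensorState b) = 0 := by
  obtain ⟨c, hc⟩ := exists_braket_tensorState_eq hX a b
  rw [hc a' b' ha hb, mul_eq_zero, Finset.prod_eq_zero_iff] at h
  have hc0 : c = 0 := h.resolve_right fun ⟨j, hj, hj0⟩ => hab j (Finset.mem_compl.mp hj) hj0
  rw [hc a b (fun _ _ => rfl) fun _ _ => rfl, hc0, zero_mul]

end Local

section Block

variable {d N m : ℕ} [NeZero N]

/-- The sites `l, …, l + m` on which `blockOp` acts. -/
def blockSet (N m : ℕ) [NeZero N] (l : ZMod N) : Finset (ZMod N) :=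
  Finset.univ.image (fun a : Fin (m + 1) => l + ((a : ℕ) : ZMod N))

theorem mem_blockSet {l j : ZMod N} :
    j ∈ blockSet N m l ↔ ∃ a : Fin (m + 1), l + ((a : ℕ) : ZMod N) = j := by
  simp [blockSet]

omit [NeZero N] in
theorem blockSites_injective (hN : m + 1 ≤ N) (l : ZMod N) :
    Function.Injective fun a : Fin (m + 1) => l + ((a : ℕ) : ZMod N) := by
  intro a b hab
  have := add_left_cancel hab
  rw [ZMod.natCast_eq_natCast_iff', Nat.mod_eq_of_lt (by omega), Nat.mod_eq_of_lt (by omega)]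
    at this
  exact Fin.ext this

theorem blockOp_mem_localAlgebra (hN : m + 1 ≤ N)
    (h : Matrix (Fin (m + 1) → Fin d) (Fin (m + 1) → Fin d) ℂ) (l : ZMod N) :
    blockOp N h l ∈ localAlgebra d (blockSet N m l) := by
  rw [blockOp_eq_placedOp]
  exact placedOp_mem_localAlgebra (blockSites_injective hN l)
    (fun a => mem_blockSet.mpr ⟨a, rfl⟩) h

theorem self_mem_blockSet (l : ZMod N) : l ∈ blockSet N m l :=
  mem_blockSet.mpr ⟨0, by simp⟩

theorem eq_of_mem_blockSet {l j : ZMod N} (hj : j ∈ blockSet N m l)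
    (hj' : j - 1 ∉ blockSet N m l) : j = l := by
  obtain ⟨a, rfl⟩ := mem_blockSet.mp hj
  rcases Nat.eq_zero_or_eq_succ_pred (a : ℕ) with ha | ha
  · simp [ha]
  · refine absurd (mem_blockSet.mpr ⟨⟨(a : ℕ).pred, by omega⟩, ?_⟩) hj'
    have hcast : ((a : ℕ) : ZMod N) = ((a : ℕ).pred : ZMod N) + 1 := by
      exact_mod_cast congrArg (Nat.cast (R := ZMod N)) ha
    rw [hcast]
    ring

theorem sub_one_notMem_blockSet (hN : m + 2 ≤ N) (l : ZMod N) : l - 1 ∉ blockSet N m l := by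
  intro hl
  obtain ⟨a, ha⟩ := mem_blockSet.mp hl
  have hcast : (((a : ℕ) + 1 : ℕ) : ZMod N) = 0 := by
    push_cast
    linear_combination ha
  rw [ZMod.natCast_eq_zero_iff] at hcast
  have := Nat.le_of_dvd (by omega) hcast
  omega

theorem card_blockSet (hN : m + 1 ≤ N) (l : ZMod N) : (blockSet N m l).card = m + 1 := by
  rw [blockSet, Finset.card_image_of_injective _ (blockSites_injective hN l), Finset.card_univ,
    Fintype.card_fin]

theorem not_blockSet_subset (hN : m + 2 ≤ N) {l l' : ZMod N} (hl : l ≠ l') :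
    ¬ blockSet N m l ⊆ blockSet N m l' := by
  intro hsub
  have heq := Finset.eq_of_subset_of_card_le hsub
    (by rw [card_blockSet (by omega), card_blockSet (by omega)])
  refine hl (eq_of_mem_blockSet (m := m) ?_ ?_).symm
  · exact heq ▸ self_mem_blockSet l'
  · exact heq ▸ sub_one_notMem_blockSet hN l'

end Block

section Derivative

theorem mem_of_hasDerivAt_of_forall_mem {E : Type*} [NormedAddCommGroup E] [NormedSpace ℝ E]
    {S : Submodule ℝ E} (hS : IsClosed (S : Set E)) {c : ℝ → E} (hc : ∀ t, c t ∈ S) {c' : E}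
    {t : ℝ} (h : HasDerivAt c c' t) : c' ∈ S := by
  have hspan : (Submodule.span ℝ (c '' Set.univ) : Set E) ⊆ S :=
    Submodule.span_le.mpr (by rintro _ ⟨s, -, rfl⟩; exact hc s)
  exact closure_minimal hspan hS
    (range_deriv_subset_closure_span_image c dense_univ ⟨t, h.deriv⟩)

theorem hasDerivAt_tensorState {d N : ℕ} [NeZero N] {a : ZMod N → ℝ → Fin d → ℂ}
    {a' : ZMod N → Fin d → ℂ} {t : ℝ} (h : ∀ j, HasDerivAt (a j) (a' j) t) :
    HasDerivAt (fun s => tensorState fun j => a j s)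
      (∑ j, tensorState (Function.update (fun i => a i t) j (a' j))) t := by
  refine hasDerivAt_pi.mpr fun σ => ?_
  refine (HasDerivAt.fun_finsetProd fun j _ => hasDerivAt_pi.mp (h j) (σ j)).congr_deriv ?_
  rw [Finset.sum_apply]
  refine Finset.sum_congr rfl fun j _ => ?_
  rw [tensorState, ← Finset.mul_prod_erase _ _ (Finset.mem_univ j), Function.update_self,
    smul_eq_mul, mul_comm]
  congr 1
  refine Finset.prod_congr rfl fun i hi => ?_
  rw [Function.update_of_ne (Finset.ne_of_mem_erase hi)]

open scoped Matrix.Norms.Operator in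
theorem hasDerivAt_exp_mulVec {n : Type*} [Fintype n] [DecidableEq n] (A : Matrix n n ℂ)
    (φ : n → ℂ) :
    HasDerivAt (fun θ : ℝ => NormedSpace.exp ((Complex.I * (θ : ℂ)) • A) *ᵥ φ)
      (Complex.I • (A *ᵥ φ)) 0 := by
  have hexp : HasDerivAt (fun θ : ℝ => NormedSpace.exp ((Complex.I * (θ : ℂ)) • A))
      (Complex.I • A) 0 := by
    have := hasDerivAt_exp_smul_const (𝕂 := ℝ) (Complex.I • A) 0
    simp only [zero_smul, NormedSpace.exp_zero, one_mul] at this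
    simp only [mul_comm Complex.I, mul_smul]
    exact this
  rw [← Matrix.smul_mulVec]
  refine hasDerivAt_pi.mpr fun i => HasDerivAt.fun_sum fun j _ => HasDerivAt.mul_const ?_ _
  exact hasDerivAt_pi.mp (hasDerivAt_pi.mp hexp i) j

end Derivative

section Scar

variable {d N : ℕ} [NeZero N] {G : Type*} [Group G] {u : G →* Matrix.unitaryGroup (Fin d) ℂ}
  {ψ : Fin d → ℂ}

/-- The rotated local anchor state `u(g) ψ`. -/
noncomputable def orbit (u : G →* Matrix.unitaryGroup (Fin d) ℂ) (ψ : Fin d → ℂ) (g : G) :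
    Fin d → ℂ :=
  (u g : Matrix (Fin d) (Fin d) ℂ) *ᵥ ψ

theorem orbit_one : orbit u ψ 1 = ψ := by
  simp [orbit]

theorem star_orbit_dotProduct_self (hψ : star ψ ⬝ᵥ ψ = 1) (g : G) :
    star (orbit u ψ g) ⬝ᵥ orbit u ψ g = 1 := by
  rw [orbit, Matrix.star_mulVec, ← Matrix.dotProduct_mulVec, Matrix.mulVec_mulVec,
    ← Matrix.star_eq_conjTranspose, Matrix.mem_unitaryGroup_iff'.mp (u g).2, Matrix.one_mulVec, hψ]

theorem scarSpace_eq_span :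
    scarSpace u ψ N =
      Submodule.span ℂ (Set.range fun g => tensorState fun _ : ZMod N => orbit u ψ g) := by
  have onsite : ∀ g, onsiteAction N (u g : Matrix (Fin d) (Fin d) ℂ) *ᵥ productState N ψ =
      tensorState fun _ => orbit u ψ g := fun g =>
    tensorOp_mulVec_tensorState (fun _ => (u g : Matrix (Fin d) (Fin d) ℂ)) fun _ => ψ
  simp only [scarSpace, onsite]

theorem tensorState_orbit_mem_scarSpace (g : G) :
    (tensorState fun _ => orbit u ψ g) ∈ scarSpace u ψ N := by
  rw [scarSpace_eq_span]
  exact Submodule.subset_span ⟨g, rfl⟩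

theorem productState_mem_scarSpace : productState N ψ ∈ scarSpace u ψ N := by
  have mem := tensorState_orbit_mem_scarSpace (N := N) (u := u) (ψ := ψ) 1
  rw [orbit_one] at mem
  exact mem

theorem isSymm_of_mem_scarSpace {Ψ : State d N} (hΨ : Ψ ∈ scarSpace u ψ N) : IsSymm Ψ := by
  intro π
  rw [scarSpace_eq_span] at hΨ
  refine LinearMap.eqOn_span (f := (permState π).toLinearMap) (g := .id) ?_ hΨ
  rintro _ ⟨g, rfl⟩
  exact isSymm_tensorState_const _ π

theorem collectiveOp_tensorState_orbit_mem {A : Matrix (Fin d) (Fin d) ℂ}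
    (hA : ∀ θ : ℝ, ∃ g : G, (u g : Matrix (Fin d) (Fin d) ℂ)
      = NormedSpace.exp ((Complex.I * (θ : ℂ)) • A)) (g : G) :
    collectiveOp N A *ᵥ (tensorState fun _ => orbit u ψ g) ∈ scarSpace u ψ N := by
  set φ := orbit u ψ g
  let curve : ℝ → State d N := fun θ =>
    tensorState fun _ => NormedSpace.exp ((Complex.I * (θ : ℂ)) • A) *ᵥ φ
  have curve_mem : ∀ θ, curve θ ∈ scarSpace u ψ N := fun θ => by
    obtain ⟨g', hg'⟩ := hA θ
    have hcurve : curve θ = tensorState fun _ => orbit u ψ (g' * g) := by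
      simp only [curve, φ, orbit, ← hg', Matrix.mulVec_mulVec, map_mul, Matrix.UnitaryGroup.mul_val]
    exact hcurve ▸ tensorState_orbit_mem_scarSpace _
  have curve_deriv : HasDerivAt curve
      (∑ j, tensorState (Function.update (fun _ => φ) j (Complex.I • (A *ᵥ φ)))) 0 := by
    simpa using hasDerivAt_tensorState (N := N) fun _ => hasDerivAt_exp_mulVec A φ
  have deriv_mem := mem_of_hasDerivAt_of_forall_mem (S := (scarSpace u ψ N).restrictScalars ℝ)
    (Submodule.closed_of_finiteDimensional _) curve_mem curve_deriv
  have deriv_eq : ∑ j, tensorState (Function.update (fun _ : ZMod N => φ) j (Complex.I • (A *ᵥ φ)))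
      = Complex.I • (collectiveOp N A *ᵥ tensorState fun _ => φ) := by
    rw [← Matrix.smul_mulVec, ← Matrix.smul_mulVec Complex.I (collectiveOp N A),
      ← collectiveOp_smul, collectiveOp]
    simp only [Matrix.sum_mulVec, siteOp_mulVec_tensorState, Matrix.smul_mulVec]
  rw [deriv_eq] at deriv_mem
  exact (Submodule.smul_mem_iff _ Complex.I_ne_zero).mp deriv_mem

theorem complexGenerators_eq_span :
    complexGenerators u = Submodule.span ℂ {A | A.IsHermitian ∧
      ∀ θ : ℝ, ∃ g : G, (u g : Matrix (Fin d) (Fin d) ℂ)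
        = NormedSpace.exp ((Complex.I * (θ : ℂ)) • A)} :=
  Submodule.span_span_of_tower ℝ ℂ _

theorem collectiveOp_mulVec_mem_scarSpace {A : Matrix (Fin d) (Fin d) ℂ}
    (hA : A ∈ complexGenerators u) {Ψ : State d N} (hΨ : Ψ ∈ scarSpace u ψ N) :
    collectiveOp N A *ᵥ Ψ ∈ scarSpace u ψ N := by
  rw [complexGenerators_eq_span] at hA
  induction hA using Submodule.span_induction with
  | zero => simp only [collectiveOp_zero, Matrix.zero_mulVec, zero_mem]
  | add A B _ _ hA hB => simpa only [collectiveOp_add, Matrix.add_mulVec] using add_mem hA hB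
  | smul c A _ hA =>
    simpa only [collectiveOp_smul, Matrix.smul_mulVec] using Submodule.smul_mem _ c hA
  | mem A hA =>
    have le : scarSpace u ψ N ≤ (scarSpace u ψ N).comap (collectiveOp N A).mulVecLin := by
      conv_lhs => rw [scarSpace_eq_span]
      refine Submodule.span_le.mpr ?_
      rintro _ ⟨g, rfl⟩
      exact collectiveOp_tensorState_orbit_mem hA.2 g
    exact le hΨ

theorem towerState_mem_scarSpace {w : List (Matrix (Fin d) (Fin d) ℂ)}
    (hw : ∀ a ∈ w, a ∈ complexGenerators u) : towerState N ψ w ∈ scarSpace u ψ N := by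
  induction w with
  | nil => exact productState_mem_scarSpace
  | cons a w ih =>
    exact collectiveOp_mulVec_mem_scarSpace (hw a List.mem_cons_self)
      (ih fun b hb => hw b (List.mem_cons_of_mem a hb))

end Scar

section Null

variable {d N m : ℕ} [NeZero N] {G : Type*} [Group G] {u : G →* Matrix.unitaryGroup (Fin d) ℂ}
  {ψ : Fin d → ℂ} {W : Finset (ZMod N)}

/-- The states that look like quasisymmetry states on the sites `W`: the span of the product
states whose factors on `W` are all equal to one `u(g) ψ`. -/
noncomputable def partialScar (u : G →* Matrix.unitaryGroup (Fin d) ℂ) (ψ : Fin d → ℂ)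
    (W : Finset (ZMod N)) : Submodule ℂ (State d N) :=
  Submodule.span ℂ {Φ | ∃ (g : G) (b : ZMod N → Fin d → ℂ),
    (∀ j ∈ W, b j = orbit u ψ g) ∧ tensorState b = Φ}

theorem scarSpace_le_partialScar (W : Finset (ZMod N)) :
    scarSpace u ψ N ≤ partialScar u ψ W := by
  rw [scarSpace_eq_span]
  refine Submodule.span_mono ?_
  rintro _ ⟨g, rfl⟩
  exact ⟨g, _, fun _ _ => rfl, rfl⟩

theorem partialScar_anti {W' : Finset (ZMod N)} (hW : W ⊆ W') :
    partialScar u ψ W' ≤ partialScar u ψ W := by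
  refine Submodule.span_mono ?_
  rintro _ ⟨g, b, hb, rfl⟩
  exact ⟨g, b, fun j hj => hb j (hW hj), rfl⟩

theorem mulVec_mem_partialScar {V : Finset (ZMod N)} (hV : Disjoint V W) {X : Op d N}
    (hX : X ∈ localAlgebra d V) {Φ : State d N} (hΦ : Φ ∈ partialScar u ψ W) :
    X *ᵥ Φ ∈ partialScar u ψ W := by
  rw [← Subalgebra.mem_toSubmodule, toSubmodule_localAlgebra] at hX
  induction hX using Submodule.span_induction with
  | zero => simp only [Matrix.zero_mulVec, zero_mem]
  | add X Y _ _ hX hY => simpa only [Matrix.add_mulVec] using add_mem hX hY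
  | smul c X _ hX => simpa only [Matrix.smul_mulVec] using Submodule.smul_mem _ c hX
  | mem X hX =>
    obtain ⟨A, hA, rfl⟩ := hX
    have le : partialScar u ψ W ≤ (partialScar u ψ W).comap (tensorOp A).mulVecLin := by
      refine Submodule.span_le.mpr ?_
      rintro _ ⟨g, b, hb, rfl⟩
      refine Submodule.subset_span ⟨g, _, fun j hj => ?_, (tensorOp_mulVec_tensorState A b).symm⟩
      rw [hA j (Finset.disjoint_right.mp hV hj), Matrix.one_mulVec, hb j hj]
    exact le hΦ

/-- `X` has no matrix elements between states that look like quasisymmetry states on `W`. -/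
def NullOn (u : G →* Matrix.unitaryGroup (Fin d) ℂ) (ψ : Fin d → ℂ) (W : Finset (ZMod N))
    (X : Op d N) : Prop :=
  ∀ Φ ∈ partialScar u ψ W, ∀ Φ' ∈ partialScar u ψ W, braket Φ X Φ' = 0

theorem NullOn.mono {W' : Finset (ZMod N)} {X : Op d N} (h : NullOn u ψ W X) (hW : W ⊆ W') :
    NullOn u ψ W' X :=
  fun Φ hΦ Φ' hΦ' => h Φ (partialScar_anti hW hΦ) Φ' (partialScar_anti hW hΦ')

theorem nullOn_of_tensorState {X : Op d N}
    (h : ∀ (g g' : G) (a b : ZMod N → Fin d → ℂ), (∀ j ∈ W, a j = orbit u ψ g) →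
      (∀ j ∈ W, b j = orbit u ψ g') → braket (tensorState a) X (tensorState b) = 0) :
    NullOn u ψ W X := by
  refine fun Φ hΦ Φ' hΦ' => braket_eq_zero_of_mem_span ?_ hΦ hΦ'
  rintro _ ⟨g, a, ha, rfl⟩ _ ⟨g', b, hb, rfl⟩
  exact h g g' a b ha hb

variable {h : Matrix (Fin (m + 1) → Fin d) (Fin (m + 1) → Fin d) ℂ}

/-- If `⟨u(g)ψ, u(g')ψ⟩ = 0`, only the block at `l` can contribute, as every other block leaves one
of its sites uncovered; otherwise all blocks contribute equally. -/
theorem nullOn_blockOp (hψ : star ψ ⬝ᵥ ψ = 1) (hN : m + 2 ≤ N)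
    (hscar : ∀ Φ ∈ scarSpace u ψ N, hamiltonian N h *ᵥ Φ = 0) (l : ZMod N) :
    NullOn u ψ (blockSet N m l) (blockOp N h l) := by
  have hloc := blockOp_mem_localAlgebra (N := N) (by omega) h
  refine nullOn_of_tensorState fun g g' a b ha hb => ?_
  have sum_eq_zero : ∀ Φ : State d N,
      ∑ l', braket Φ (blockOp N h l') (tensorState fun _ => orbit u ψ g') = 0 := fun Φ => by
    rw [← LinearMap.sum_apply, ← map_sum, braket_apply]
    exact (congrArg _ (hscar _ (tensorState_orbit_mem_scarSpace g'))).trans (dotProduct_zero _)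
  by_cases orthogonal : star (orbit u ψ g) ⬝ᵥ orbit u ψ g' = 0
  · refine braket_tensorState_eq_zero_of_agree (hloc l)
      (a' := fun j => if j ∈ blockSet N m l then orbit u ψ g else orbit u ψ g')
      (b' := fun _ => orbit u ψ g') (fun j hj => by simp [hj, ha j hj])
      (fun j hj => (hb j hj).symm) (fun j hj => by simp [hj, star_orbit_dotProduct_self hψ]) ?_
    rw [← sum_eq_zero, Finset.sum_eq_single l _ (by simp)]
    intro l' _ hl'
    obtain ⟨j, hj, hj'⟩ := Finset.not_subset.mp (not_blockSet_subset hN hl'.symm)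
    exact braket_tensorState_eq_zero_of_orthogonal (hloc l') hj' (by simp [hj, orthogonal])
  · refine braket_tensorState_eq_zero_of_agree (hloc l) (a' := fun _ => orbit u ψ g)
      (b' := fun _ => orbit u ψ g') (fun j hj => (ha j hj).symm) (fun j hj => (hb j hj).symm)
      (fun _ _ => orthogonal) ?_
    have translate : ∀ l', braket (tensorState fun _ => orbit u ψ g) (blockOp N h l')
        (tensorState fun _ => orbit u ψ g') = braket (tensorState fun _ => orbit u ψ g)
        (blockOp N h l) (tensorState fun _ => orbit u ψ g') := fun l' => by
      rw [← IsSymm.braket_permOp (isSymm_tensorState_const _) (isSymm_tensorState_const _)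
        (Equiv.addRight (l' - l)) (blockOp N h l), permOp_addRight_blockOp, add_sub_cancel]
    simpa [translate, NeZero.ne N] using sum_eq_zero (tensorState fun _ => orbit u ψ g)

theorem NullOn.mul_of_disjoint {V : Finset (ZMod N)} {X Y : Op d N} (hX : NullOn u ψ W X)
    (hY : Y ∈ localAlgebra d V) (hV : Disjoint V W) : NullOn u ψ W (X * Y) :=
  fun Φ hΦ Φ' hΦ' => by
    rw [braket_mul]
    exact hX Φ hΦ _ (mulVec_mem_partialScar hV hY hΦ')

theorem nullOn_sum_blockOp_mul (hψ : star ψ ⬝ᵥ ψ = 1) (hN : m + 2 ≤ N)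
    (hscar : ∀ Φ ∈ scarSpace u ψ N, hamiltonian N h *ᵥ Φ = 0) (l : ZMod N)
    {near : Finset (ZMod N)} (hfar : ∀ t ∉ near, Disjoint (blockSet N m t) (blockSet N m l))
    (hlW : blockSet N m l ⊆ W) (hnearW : ∀ t ∈ near, blockSet N m t ⊆ W)
    {p : ZMod N} (hpW : p ∈ W) (hpl : p ∉ blockSet N m l)
    (hpnear : ∀ t ∈ near, p ∉ blockSet N m t) :
    NullOn u ψ W (∑ t ∈ near, blockOp N h l * blockOp N h t) := by
  have hloc := blockOp_mem_localAlgebra (N := N) (by omega) h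
  have mul_mem : ∀ {V : Finset (ZMod N)} {t}, blockSet N m l ⊆ V → blockSet N m t ⊆ V →
      blockOp N h l * blockOp N h t ∈ localAlgebra d V := fun hl ht =>
    mul_mem (localAlgebra_mono hl (hloc l)) (localAlgebra_mono ht (hloc _))
  refine nullOn_of_tensorState fun g g' a b ha hb => ?_
  by_cases orthogonal : star (orbit u ψ g) ⬝ᵥ orbit u ψ g' = 0
  · simp only [map_sum, LinearMap.sum_apply]
    refine Finset.sum_eq_zero fun t ht => ?_
    refine braket_tensorState_eq_zero_of_orthogonal (j := p)
      (mul_mem Finset.subset_union_left (Finset.subset_union_right (s₂ := blockSet N m t))) ?_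
      (by rw [ha p hpW, hb p hpW, orthogonal])
    simp [hpl, hpnear t ht]
  · refine braket_tensorState_eq_zero_of_agree
      (sum_mem fun t ht => mul_mem hlW (hnearW t ht)) (a' := fun _ => orbit u ψ g)
      (b' := fun _ => orbit u ψ g') (fun j hj => (ha j hj).symm) (fun j hj => (hb j hj).symm)
      (fun _ _ => orthogonal) ?_
    have total : braket (tensorState fun _ => orbit u ψ g)
        (∑ t, blockOp N h l * blockOp N h t) (tensorState fun _ => orbit u ψ g') = 0 := by
      rw [← Finset.mul_sum, braket_mul]
      exact (congrArg _ (hscar _ (tensorState_orbit_mem_scarSpace g'))).trans (map_zero _)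
    rw [← Finset.sum_add_sum_compl near, map_add, LinearMap.add_apply] at total
    rw [← total, left_eq_add, map_sum, LinearMap.sum_apply]
    refine Finset.sum_eq_zero fun t ht => ?_
    have mem := fun g : G => scarSpace_le_partialScar (blockSet N m l)
      (tensorState_orbit_mem_scarSpace (u := u) (ψ := ψ) g)
    exact (nullOn_blockOp hψ hN hscar l).mul_of_disjoint (hloc t)
      (hfar t (Finset.mem_compl.mp ht)) _ (mem g) _ (mem g')

end Null

section Norm

open scoped Matrix.Norms.L2Operator

variable {n : Type*} [Fintype n] [DecidableEq n]

theorem norm_braket_le (Φ : n → ℂ) (X : Matrix n n ℂ) (Φ' : n → ℂ) :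
    ‖braket Φ X Φ'‖ ≤ ‖X‖ * (‖WithLp.toLp 2 Φ‖ * ‖WithLp.toLp 2 Φ'‖) := by
  have inner_eq : braket Φ X Φ' = inner ℂ (WithLp.toLp 2 Φ) (WithLp.toLp 2 (X *ᵥ Φ')) := by
    rw [EuclideanSpace.inner_toLp_toLp, dotProduct_comm, braket_apply]
  rw [inner_eq, mul_left_comm]
  refine (norm_inner_le_norm _ _).trans ?_
  gcongr
  exact Matrix.l2_opNorm_mulVec X (WithLp.toLp 2 Φ')

theorem braket_one_self (Φ : n → ℂ) : braket Φ 1 Φ = ((‖WithLp.toLp 2 Φ‖ ^ 2 : ℝ) : ℂ) := by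
  rw [braket_one, dotProduct_comm, ← EuclideanSpace.inner_toLp_toLp, inner_self_eq_norm_sq_to_K]
  norm_cast

theorem norm_braket_le_of_braket_one_eq {Φ Φ' : n → ℂ} (X : Matrix n n ℂ) {x : ℂ}
    (h : braket Φ 1 Φ = x) (h' : braket Φ' 1 Φ' = x) : ‖braket Φ X Φ'‖ ≤ ‖X‖ * ‖x‖ := by
  have norm_sq : ∀ Φ : n → ℂ, ‖WithLp.toLp 2 Φ‖ ^ 2 = ‖braket Φ 1 Φ‖ := fun Φ => by
    rw [braket_one_self, Complex.norm_real, Real.norm_of_nonneg (by positivity)]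
  have norm_eq : ‖WithLp.toLp 2 Φ'‖ = ‖WithLp.toLp 2 Φ‖ := by
    rw [← sq_eq_sq₀ (norm_nonneg _) (norm_nonneg _), norm_sq, norm_sq, h, h']
  refine (norm_braket_le Φ X Φ').trans_eq ?_
  rw [norm_eq, ← sq, norm_sq, h]

theorem norm_le_one_of_isIdempotentElem {X : Matrix n n ℂ} (h : IsIdempotentElem (Xᴴ * X)) :
    ‖X‖ ≤ 1 := by
  have norm_sq : ∀ Y : Matrix n n ℂ, ‖Yᴴ * Y‖ = ‖Y‖ * ‖Y‖ := fun _ => CStarRing.norm_star_mul_self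
  have idem := norm_sq (Xᴴ * X)
  rw [Matrix.conjTranspose_mul, Matrix.conjTranspose_conjTranspose, h.eq] at idem
  have : ‖Xᴴ * X‖ ≤ 1 := by nlinarith [norm_nonneg (Xᴴ * X)]
  rw [norm_sq] at this
  nlinarith [norm_nonneg X]

variable {d N : ℕ} [NeZero N] {ι : Type*} [Fintype ι] {f : ι → ZMod N}

theorem norm_placedOp_single_le_one (hf : Function.Injective f) (s t : ι → Fin d) :
    ‖(placedOp f (Matrix.single s t 1) : Op d N)‖ ≤ 1 := by
  rw [placedOp_single hf]
  refine norm_le_one_of_isIdempotentElem ?_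
  rw [tensorOp_conjTranspose, ← map_mul, IsIdempotentElem, ← map_mul]
  congr 1
  ext j : 1
  by_cases hj : ∃ a, f a = j
  · obtain ⟨a, rfl⟩ := hj
    simp [hf.extend_apply]
  · simp [Function.extend_apply' _ _ _ hj]

theorem norm_placedOp_le [DecidableEq ι] (hf : Function.Injective f)
    (h : Matrix (ι → Fin d) (ι → Fin d) ℂ) :
    ‖(placedOp f h : Op d N)‖ ≤ ∑ s, ∑ t, ‖h s t‖ := by
  rw [placedOp_eq_sum_tensorOp hf]
  refine norm_sum_le_of_le _ fun s _ => norm_sum_le_of_le _ fun t _ => ?_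
  rw [norm_smul, ← placedOp_single hf]
  exact mul_le_of_le_one_right (norm_nonneg _) (norm_placedOp_single_le_one hf s t)

theorem norm_blockOp_le {m : ℕ} (hN : m + 1 ≤ N)
    (h : Matrix (Fin (m + 1) → Fin d) (Fin (m + 1) → Fin d) ℂ) (l : ZMod N) :
    ‖blockOp N h l‖ ≤ ∑ s, ∑ t, ‖h s t‖ := by
  rw [blockOp_eq_placedOp]
  exact norm_placedOp_le (blockSites_injective hN l) h

end Norm

section Twist

variable {d N : ℕ} [NeZero N] (q : Matrix (Fin d) (Fin d) ℂ) {Ψ : State d N}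
  (χ : AddChar (ZMod N) ℂ)

/-- The twisted state `∑ⱼ χ(j) qⱼ Ψ`. -/
noncomputable def twist (χ : AddChar (ZMod N) ℂ) (q : Matrix (Fin d) (Fin d) ℂ) (Ψ : State d N) :
    State d N :=
  ∑ j, χ j • (siteOp N q j *ᵥ Ψ)

/-- The state `(qⱼ - qᵣ) Ψ`. -/
noncomputable def siteDiff (q : Matrix (Fin d) (Fin d) ℂ) (Ψ : State d N) (r j : ZMod N) :
    State d N :=
  siteOp N q j *ᵥ Ψ - siteOp N q r *ᵥ Ψ

theorem IsSymm.permState_siteOp_mulVec (hΨ : IsSymm Ψ) (π : Equiv.Perm (ZMod N)) (j : ZMod N) :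
    permState π (siteOp N q j *ᵥ Ψ) = siteOp N q (π j) *ᵥ Ψ := by
  rw [permState_mulVec, permOp_siteOp, hΨ π]

theorem IsSymm.permState_siteDiff (hΨ : IsSymm Ψ) (π : Equiv.Perm (ZMod N)) (r j : ZMod N) :
    permState π (siteDiff q Ψ r j) = siteDiff q Ψ (π r) (π j) := by
  simp only [siteDiff, map_sub, hΨ.permState_siteOp_mulVec]

theorem IsSymm.braket_siteDiff_perm (hΨ : IsSymm Ψ) (π : Equiv.Perm (ZMod N)) (X : Op d N)
    (r i j : ZMod N) :
    braket (siteDiff q Ψ (π r) (π i)) (permOp π X) (siteDiff q Ψ (π r) (π j)) =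
      braket (siteDiff q Ψ r i) X (siteDiff q Ψ r j) := by
  rw [← hΨ.permState_siteDiff, ← hΨ.permState_siteDiff, braket_permState]

theorem IsSymm.braket_siteDiff_self_eq (hΨ : IsSymm Ψ) {r i r' i' : ZMod N} (h : i ≠ r)
    (h' : i' ≠ r') :
    braket (siteDiff q Ψ r i) 1 (siteDiff q Ψ r i) =
      braket (siteDiff q Ψ r' i') 1 (siteDiff q Ψ r' i') := by
  obtain ⟨π, hπ⟩ := Equiv.Perm.exists_extending_pair ![i, r] ![i', r']
    (by simpa [Function.Injective, Fin.forall_fin_two, eq_comm] using h)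
    (by simpa [Function.Injective, Fin.forall_fin_two, eq_comm] using h')
  obtain ⟨rfl, rfl⟩ : π i = i' ∧ π r = r' := by simpa [Fin.forall_fin_two] using hπ
  rw [← hΨ.braket_siteDiff_perm q π, map_one]

variable {χ}

theorem star_addChar_mul (i j : ZMod N) : star (χ i) * χ j = χ (j - i) := by
  rw [Complex.star_def, ← AddChar.map_neg_eq_conj, ← AddChar.map_add_eq_mul, neg_add_eq_sub]

theorem IsSymm.braket_twist_permOp_addRight (hΨ : IsSymm Ψ) (X : Op d N) (t : ZMod N) :
    braket (twist χ q Ψ) (permOp (Equiv.addRight t) X) (twist χ q Ψ) =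
      braket (twist χ q Ψ) X (twist χ q Ψ) := by
  have translate : twist χ q Ψ = χ t • permState (Equiv.addRight t) (twist χ q Ψ) := by
    simp only [twist, map_sum, map_smul, hΨ.permState_siteOp_mulVec, Finset.smul_sum, smul_smul,
      ← AddChar.map_add_eq_mul]
    rw [← Equiv.sum_comp (Equiv.addRight t)]
    simp only [Equiv.coe_addRight, add_comm t]
  conv_lhs => rw [translate]
  simp only [map_smulₛₗ, LinearMap.smul_apply, RingHom.id_apply, smul_smul, braket_permState,
    starRingEnd_apply]
  rw [mul_comm, star_addChar_mul, sub_self, AddChar.map_zero_eq_one, one_smul]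

/-- For `χ ≠ 1` the phases sum to zero, so a reference site `r` may be subtracted. -/
theorem twist_eq_sum_siteDiff (hχ : χ ≠ 1) (Ψ : State d N) (r : ZMod N) :
    twist χ q Ψ = ∑ j, χ j • siteDiff q Ψ r j := by
  simp only [siteDiff, smul_sub, Finset.sum_sub_distrib, ← Finset.sum_smul,
    AddChar.sum_eq_zero_of_ne_one hχ, zero_smul, sub_zero, twist]

theorem IsSymm.exists_braket_siteOp_mulVec (hΨ : IsSymm Ψ) {r i₀ : ZMod N} (h : i₀ ≠ r) :
    ∃ c, ∀ i j, braket (siteOp N q i *ᵥ Ψ) 1 (siteOp N q j *ᵥ Ψ) =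
      c + if i = j then braket (siteDiff q Ψ r i₀) 1 (siteDiff q Ψ r i₀) / 2 else 0 := by
  have perm : ∀ π : Equiv.Perm (ZMod N), ∀ i j, braket (siteOp N q i *ᵥ Ψ) 1 (siteOp N q j *ᵥ Ψ) =
      braket (siteOp N q (π i) *ᵥ Ψ) 1 (siteOp N q (π j) *ᵥ Ψ) := fun π i j => by
    rw [← braket_permState π, map_one, hΨ.permState_siteOp_mulVec, hΨ.permState_siteOp_mulVec]
  have diag : ∀ i, braket (siteOp N q i *ᵥ Ψ) 1 (siteOp N q i *ᵥ Ψ) =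
      braket (siteOp N q i₀ *ᵥ Ψ) 1 (siteOp N q i₀ *ᵥ Ψ) := fun i => by
    rw [perm (Equiv.swap i i₀), Equiv.swap_apply_left]
  have offDiag : ∀ i j, i ≠ j → braket (siteOp N q i *ᵥ Ψ) 1 (siteOp N q j *ᵥ Ψ) =
      braket (siteOp N q i₀ *ᵥ Ψ) 1 (siteOp N q r *ᵥ Ψ) := fun i j hij => by
    obtain ⟨π, hπ⟩ := Equiv.Perm.exists_extending_pair ![i, j] ![i₀, r]
      (by simpa [Function.Injective, Fin.forall_fin_two, eq_comm] using hij)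
      (by simpa [Function.Injective, Fin.forall_fin_two, eq_comm] using h)
    obtain ⟨hi, hj⟩ : π i = i₀ ∧ π j = r := by simpa [Fin.forall_fin_two] using hπ
    rw [perm π, hi, hj]
  refine ⟨braket (siteOp N q i₀ *ᵥ Ψ) 1 (siteOp N q r *ᵥ Ψ), fun i j => ?_⟩
  split_ifs with hij
  · subst hij
    simp only [siteDiff, map_sub, LinearMap.sub_apply, diag r, offDiag r i₀ h.symm, diag i]
    ring
  · rw [add_zero, offDiag i j hij]

theorem IsSymm.braket_twist_self (hΨ : IsSymm Ψ) (hχ : χ ≠ 1) {r i₀ : ZMod N} (h : i₀ ≠ r) :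
    braket (twist χ q Ψ) 1 (twist χ q Ψ) =
      N * (braket (siteDiff q Ψ r i₀) 1 (siteDiff q Ψ r i₀) / 2) := by
  obtain ⟨c, hc⟩ := hΨ.exists_braket_siteOp_mulVec q h
  set D := braket (siteDiff q Ψ r i₀) 1 (siteDiff q Ψ r i₀) / 2
  have row : ∀ i, ∑ j, star (χ i) * χ j * (c + if i = j then D else 0) = D := fun i => by
    simp only [mul_add, mul_assoc, Finset.sum_add_distrib, ← Finset.mul_sum, ← Finset.sum_mul,
      AddChar.sum_eq_zero_of_ne_one hχ, zero_mul, mul_zero, zero_add, mul_ite, Finset.sum_ite_eq,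
      Finset.mem_univ, if_true]
    rw [← mul_assoc, star_addChar_mul, sub_self, AddChar.map_zero_eq_one, one_mul]
  calc braket (twist χ q Ψ) 1 (twist χ q Ψ)
      = ∑ i, ∑ j, star (χ i) * χ j * (c + if i = j then D else 0) := by
        simp only [twist, map_sum, map_smulₛₗ, LinearMap.sum_apply, LinearMap.smul_apply,
          smul_eq_mul, RingHom.id_apply, hc, starRingEnd_apply, mul_assoc, Finset.mul_sum]
        rw [Finset.sum_comm]
        exact Finset.sum_congr rfl fun i _ => Finset.sum_congr rfl fun j _ => mul_left_comm _ _ _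
    _ = N * D := by
        simp only [row, Finset.sum_const, Finset.card_univ, ZMod.card, nsmul_eq_mul]

end Twist

section Core

variable {d N : ℕ} [NeZero N] {G : Type*} [Group G] {u : G →* Matrix.unitaryGroup (Fin d) ℂ}
  {ψ : Fin d → ℂ} {q : Matrix (Fin d) (Fin d) ℂ} {Ψ : State d N} {W W' : Finset (ZMod N)}
  {X : Op d N} {r : ZMod N}

theorem siteOp_mulVec_mem_partialScar (A : Matrix (Fin d) (Fin d) ℂ) (hΨ : Ψ ∈ scarSpace u ψ N)
    {j : ZMod N} (hj : j ∉ W) : siteOp N A j *ᵥ Ψ ∈ partialScar u ψ W :=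
  mulVec_mem_partialScar (Finset.disjoint_singleton_left.mpr hj)
    (siteOp_mem_localAlgebra A (Finset.mem_singleton_self j)) (scarSpace_le_partialScar W hΨ)

theorem siteDiff_mem_partialScar (q : Matrix (Fin d) (Fin d) ℂ) (hΨ : Ψ ∈ scarSpace u ψ N)
    {j : ZMod N} (hr : r ∉ W) (hj : j ∉ W) : siteDiff q Ψ r j ∈ partialScar u ψ W :=
  sub_mem (siteOp_mulVec_mem_partialScar q hΨ hj) (siteOp_mulVec_mem_partialScar q hΨ hr)

theorem sum_siteDiff_mem_partialScar (hq : q ∈ complexGenerators u) (hΨ : Ψ ∈ scarSpace u ψ N)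
    (hr : r ∉ W) : ∑ j ∈ W, siteDiff q Ψ r j ∈ partialScar u ψ W := by
  have split : ∑ j ∈ W, siteDiff q Ψ r j = collectiveOp N q *ᵥ Ψ
      - ∑ j ∈ Wᶜ, siteOp N q j *ᵥ Ψ - ∑ _j ∈ W, siteOp N q r *ᵥ Ψ := by
    rw [collectiveOp, Matrix.sum_mulVec, ← Finset.sum_add_sum_compl W]
    simp only [siteDiff, Finset.sum_sub_distrib, add_sub_cancel_right]
  rw [split]
  refine sub_mem (sub_mem (scarSpace_le_partialScar W (collectiveOp_mulVec_mem_scarSpace hq hΨ))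
    (sum_mem fun j hj => ?_)) (sum_mem fun _ _ => siteOp_mulVec_mem_partialScar q hΨ hr)
  exact siteOp_mulVec_mem_partialScar q hΨ (Finset.mem_compl.mp hj)

theorem NullOn.sum_braket_siteDiff_right (hX : NullOn u ψ W X) (hq : q ∈ complexGenerators u)
    (hΨ : Ψ ∈ scarSpace u ψ N) (hr : r ∉ W) {Φ : State d N} (hΦ : Φ ∈ partialScar u ψ W) :
    ∑ j ∈ W, braket Φ X (siteDiff q Ψ r j) = 0 := by
  rw [← map_sum]
  exact hX Φ hΦ _ (sum_siteDiff_mem_partialScar hq hΨ hr)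

theorem NullOn.sum_braket_siteDiff_left (hX : NullOn u ψ W X) (hq : q ∈ complexGenerators u)
    (hΨ : Ψ ∈ scarSpace u ψ N) (hr : r ∉ W) {Φ : State d N} (hΦ : Φ ∈ partialScar u ψ W) :
    ∑ j ∈ W, braket (siteDiff q Ψ r j) X Φ = 0 := by
  simp only [← LinearMap.sum_apply, ← map_sum]
  exact hX _ (sum_siteDiff_mem_partialScar hq hΨ hr) Φ hΦ

theorem NullOn.sum_sum_braket_siteDiff (hX : NullOn u ψ W X) (hq : q ∈ complexGenerators u)
    (hΨ : Ψ ∈ scarSpace u ψ N) (hr : r ∉ W) :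
    ∑ i ∈ W, ∑ j ∈ W, braket (siteDiff q Ψ r i) X (siteDiff q Ψ r j) = 0 := by
  rw [Finset.sum_comm]
  simp only [← LinearMap.sum_apply, ← map_sum]
  exact hX _ (sum_siteDiff_mem_partialScar hq hΨ hr) _ (sum_siteDiff_mem_partialScar hq hΨ hr)

/-- Exchanging the sites `j` and `r` flips the sign of `(qⱼ - qᵣ) Ψ` and fixes `X` and `qᵢ Ψ`. -/
theorem IsSymm.braket_siteOp_siteDiff (hΨ : IsSymm Ψ) (hX : X ∈ localAlgebra d W) (hr : r ∉ W)
    {i j : ZMod N} (hi : i ∈ W) (hj : j ∉ W) :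
    braket (siteOp N q i *ᵥ Ψ) X (siteDiff q Ψ r j) = 0 ∧
      braket (siteDiff q Ψ r j) X (siteOp N q i *ᵥ Ψ) = 0 := by
  have fixes : ∀ i ∈ W, Equiv.swap j r i = i := fun i hi =>
    Equiv.swap_apply_of_ne_of_ne (ne_of_mem_of_not_mem hi hj) (ne_of_mem_of_not_mem hi hr)
  have flip : permState (Equiv.swap j r) (siteDiff q Ψ r j) = -siteDiff q Ψ r j := by
    rw [hΨ.permState_siteDiff, Equiv.swap_apply_left, Equiv.swap_apply_right, siteDiff, siteDiff,
      neg_sub]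
  have fix : permState (Equiv.swap j r) (siteOp N q i *ᵥ Ψ) = siteOp N q i *ᵥ Ψ := by
    rw [hΨ.permState_siteOp_mulVec, fixes i hi]
  have hXfix := permOp_eq_self_of_mem_localAlgebra fixes hX
  constructor <;>
    refine self_eq_neg.mp ((braket_permState (Equiv.swap j r) _ X _).symm.trans ?_) <;>
    simp only [fix, flip, hXfix, map_neg, LinearMap.neg_apply]

theorem NullOn.braket_siteDiff_eq_zero (hXW : NullOn u ψ W X) (hX : X ∈ localAlgebra d W)
    (hΨ : Ψ ∈ scarSpace u ψ N) (hr : r ∉ W) {i j : ZMod N} (hij : i ∉ W ∨ j ∉ W) :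
    braket (siteDiff q Ψ r i) X (siteDiff q Ψ r j) = 0 := by
  have mem := fun j (hj : j ∉ W) => siteDiff_mem_partialScar q hΨ hr hj
  have mem_r := siteOp_mulVec_mem_partialScar q hΨ hr
  have flip := fun i j hi hj =>
    (isSymm_of_mem_scarSpace hΨ).braket_siteOp_siteDiff (q := q) hX hr (i := i) (j := j) hi hj
  by_cases hi : i ∈ W
  · have hj : j ∉ W := hij.resolve_left (not_not.mpr hi)
    rw [siteDiff.eq_1 q Ψ r i, map_sub, LinearMap.sub_apply, LinearMap.sub_apply,
      (flip i j hi hj).1, hXW _ mem_r _ (mem j hj), sub_zero]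
  by_cases hj : j ∈ W
  · rw [siteDiff.eq_1 q Ψ r j, map_sub, (flip j i hj hi).2, hXW _ (mem i hi) _ mem_r, sub_zero]
  · exact hXW _ (mem i hi) _ (mem j hj)

variable {χ : AddChar (ZMod N) ℂ}

theorem NullOn.braket_twist_eq (hXW : NullOn u ψ W X) (hX : X ∈ localAlgebra d W) (hχ : χ ≠ 1)
    (hΨ : Ψ ∈ scarSpace u ψ N) (hr : r ∉ W) :
    braket (twist χ q Ψ) X (twist χ q Ψ) =
      ∑ i ∈ W, ∑ j ∈ W, χ (j - i) * braket (siteDiff q Ψ r i) X (siteDiff q Ψ r j) := by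
  have expand : braket (twist χ q Ψ) X (twist χ q Ψ) =
      ∑ i, ∑ j, χ (j - i) * braket (siteDiff q Ψ r i) X (siteDiff q Ψ r j) := by
    rw [twist_eq_sum_siteDiff q hχ Ψ r, Finset.sum_comm]
    simp only [map_sum, map_smulₛₗ, LinearMap.sum_apply, LinearMap.smul_apply, smul_eq_mul,
      RingHom.id_apply, starRingEnd_apply, Finset.mul_sum, ← star_addChar_mul]
    exact Finset.sum_congr rfl fun j _ => Finset.sum_congr rfl fun i _ => by ring
  have vanish := fun i j => hXW.braket_siteDiff_eq_zero (q := q) hX hΨ hr (i := i) (j := j)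
  rw [expand, ← Finset.sum_subset W.subset_univ]
  · refine Finset.sum_congr rfl fun i _ => (Finset.sum_subset W.subset_univ fun j _ hj => ?_).symm
    rw [vanish i j (.inr hj), mul_zero]
  · refine fun i _ hi => Finset.sum_eq_zero fun j _ => ?_
    rw [vanish i j (.inl hi), mul_zero]

theorem NullOn.braket_twist_union_eq (hXW : NullOn u ψ W X) (hXW' : NullOn u ψ W' X)
    (hX : X ∈ localAlgebra d (W ∪ W')) (hd : Disjoint W W') (hχ : χ ≠ 1)
    (hΨ : Ψ ∈ scarSpace u ψ N) (hr : r ∉ W) (hr' : r ∉ W') :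
    braket (twist χ q Ψ) X (twist χ q Ψ) = ∑ i ∈ W, ∑ j ∈ W',
      (χ (j - i) * braket (siteDiff q Ψ r i) X (siteDiff q Ψ r j) +
        χ (i - j) * braket (siteDiff q Ψ r j) X (siteDiff q Ψ r i)) := by
  rw [(hXW.mono Finset.subset_union_left).braket_twist_eq hX hχ hΨ
    (Finset.notMem_union.mpr ⟨hr, hr'⟩)]
  have diag : ∑ i ∈ W, ∑ j ∈ W, χ (j - i) * braket (siteDiff q Ψ r i) X (siteDiff q Ψ r j) = 0 :=
    Finset.sum_eq_zero fun i hi => Finset.sum_eq_zero fun j hj => by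
      rw [hXW' _ (siteDiff_mem_partialScar q hΨ hr' (Finset.disjoint_left.mp hd hi)) _
        (siteDiff_mem_partialScar q hΨ hr' (Finset.disjoint_left.mp hd hj)), mul_zero]
  have diag' : ∑ i ∈ W', ∑ j ∈ W', χ (j - i) * braket (siteDiff q Ψ r i) X (siteDiff q Ψ r j) =
      0 := Finset.sum_eq_zero fun i hi => Finset.sum_eq_zero fun j hj => by
    rw [hXW _ (siteDiff_mem_partialScar q hΨ hr (Finset.disjoint_right.mp hd hi)) _
      (siteDiff_mem_partialScar q hΨ hr (Finset.disjoint_right.mp hd hj)), mul_zero]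
  simp only [Finset.sum_union hd, Finset.sum_add_distrib, diag, diag', zero_add, add_zero]
  rw [add_right_inj, Finset.sum_comm]

end Core

section EventuallyPoly

open Filter Topology Polynomial

theorem tendsto_eval_div_pow (p : ℂ[X]) {D : ℕ} (hD : p.natDegree ≤ D) :
    Tendsto (fun n : ℕ => p.eval (n : ℂ) / (n : ℂ) ^ D) atTop (𝓝 (p.coeff D)) := by
  have limit := ((p.reflect D).continuous.tendsto 0).comp
    (tendsto_inv_atTop_nhds_zero_nat (𝕜 := ℂ))
  rw [← coeff_zero_eq_eval_zero, coeff_reflect, revAt_le D.zero_le, Nat.sub_zero] at limit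
  refine limit.congr' ?_
  filter_upwards [eventually_ne_atTop 0] with n hn
  have hn' : (n : ℂ) ≠ 0 := Nat.cast_ne_zero.mpr hn
  let := invertibleOfNonzero hn'
  rw [eq_div_iff (pow_ne_zero D hn'), Function.comp_apply, ← invOf_eq_inv]
  exact eval₂_reflect_mul_pow (RingHom.id ℂ) (n : ℂ) D p hD

theorem exists_tendsto_eval_div_eval {p q : ℂ[X]} {C : ℝ}
    (h : ∀ᶠ n : ℕ in atTop, ‖p.eval (n : ℂ)‖ ≤ C * ‖q.eval (n : ℂ)‖) :
    ∃ L, Tendsto (fun n : ℕ => p.eval (n : ℂ) / q.eval (n : ℂ)) atTop (𝓝 L) := by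
  by_cases hq : q = 0
  · exact ⟨0, by simp [hq]⟩
  have natDegree_le : p.natDegree ≤ q.natDegree := by
    by_contra! hlt
    have bound := (tendsto_eval_div_pow q hlt.le).norm.const_mul C
    rw [coeff_eq_zero_of_natDegree_lt hlt, norm_zero, mul_zero] at bound
    have leading : p.leadingCoeff = 0 := by
      refine tendsto_nhds_unique (tendsto_eval_div_pow p le_rfl) (squeeze_zero_norm' ?_ bound)
      filter_upwards [h] with n hn
      rw [norm_div, norm_div, ← mul_div_assoc]
      gcongr
    rw [leadingCoeff_eq_zero.mp leading, natDegree_zero] at hlt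
    exact hlt.not_ge zero_le
  refine ⟨_, ((tendsto_eval_div_pow p natDegree_le).div (tendsto_eval_div_pow q le_rfl)
    (leadingCoeff_ne_zero.mpr hq)).congr' ?_⟩
  filter_upwards [eventually_ne_atTop 0] with n hn
  exact div_div_div_cancel_right₀ (pow_ne_zero _ (Nat.cast_ne_zero.mpr hn)) _ _

/-- The algebra of sequences that agree with a polynomial for all large arguments. -/
noncomputable def eventuallyPoly : Subalgebra ℂ (ℕ → ℂ) where
  carrier := {f | ∃ p : ℂ[X], ∀ᶠ n : ℕ in atTop, f n = p.eval (n : ℂ)}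
  add_mem' := by
    rintro f g ⟨p, hp⟩ ⟨q, hq⟩
    exact ⟨p + q, by filter_upwards [hp, hq] with n hn hn'; simp [hn, hn']⟩
  mul_mem' := by
    rintro f g ⟨p, hp⟩ ⟨q, hq⟩
    exact ⟨p * q, by filter_upwards [hp, hq] with n hn hn'; simp [hn, hn']⟩
  algebraMap_mem' c := ⟨C c, by simp⟩

variable {f g : ℕ → ℂ}

theorem mem_eventuallyPoly_congr (h : f =ᶠ[atTop] g) (hg : g ∈ eventuallyPoly) :
    f ∈ eventuallyPoly := by
  obtain ⟨p, hp⟩ := hg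
  exact ⟨p, h.trans hp⟩

theorem natCast_mem_eventuallyPoly : (fun n : ℕ => (n : ℂ)) ∈ eventuallyPoly := ⟨X, by simp⟩

theorem sum_range_succ_mem_eventuallyPoly {g : ℕ → ℕ → ℂ} (hg : ∀ t, g t ∈ eventuallyPoly)
    {s : ℕ} (hs : ∀ n t, s ≤ t → t ≤ n → g t n = g s n) :
    (fun n => ∑ t ∈ Finset.range (n + 1), g t n) ∈ eventuallyPoly := by
  have mem : ∑ t ∈ Finset.range s, g t + ((fun n : ℕ => (n : ℂ)) + algebraMap ℂ _ (1 - s)) * g s ∈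
      eventuallyPoly :=
    add_mem (sum_mem fun t _ => hg t)
      (mul_mem (add_mem natCast_mem_eventuallyPoly (eventuallyPoly.algebraMap_mem _)) (hg s))
  refine mem_eventuallyPoly_congr ?_ mem
  filter_upwards [eventually_ge_atTop s] with n hn
  have tail : ∑ t ∈ Finset.Ico s (n + 1), g t n = ((n : ℂ) + (1 - s)) * g s n := by
    rw [Finset.sum_congr rfl fun t ht => hs n t (Finset.mem_Ico.mp ht).1
      (Nat.lt_succ_iff.mp (Finset.mem_Ico.mp ht).2), Finset.sum_const, Nat.card_Ico, nsmul_eq_mul,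
      Nat.cast_sub (by omega)]
    push_cast
    ring
  rw [← Finset.sum_range_add_sum_Ico _ (show s ≤ n + 1 by omega), tail]
  simp

theorem exists_tendsto_div_of_mem_eventuallyPoly (hf : f ∈ eventuallyPoly)
    (hg : g ∈ eventuallyPoly) {C : ℝ} (h : ∀ᶠ n in atTop, ‖f n‖ ≤ C * ‖g n‖) :
    ∃ L, Tendsto (fun n => f n / g n) atTop (𝓝 L) := by
  obtain ⟨p, hp⟩ := hf
  obtain ⟨q, hq⟩ := hg
  have bound : ∀ᶠ n : ℕ in atTop, ‖p.eval (n : ℂ)‖ ≤ C * ‖q.eval (n : ℂ)‖ := by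
    filter_upwards [hp, hq, h] with n hp hq h
    rwa [← hp, ← hq]
  obtain ⟨L, hL⟩ := exists_tendsto_eval_div_eval bound
  refine ⟨L, hL.congr' ?_⟩
  filter_upwards [hp, hq] with n hp hq
  rw [hp, hq]

end EventuallyPoly

section Words

open Filter

variable {d : ℕ}

/-- Families of operators, one for each chain of `n + 1` sites. -/
abbrev OpFamily (d : ℕ) : Type := ∀ n : ℕ, Op d (n + 1)

/-- The product operators cut out of a sequence of one-site operators. -/
noncomputable def tensorFamily : (ℕ → Matrix (Fin d) (Fin d) ℂ) →* OpFamily d where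
  toFun F _ := tensorOp fun j => F j.val
  map_one' := funext fun _ => map_one tensorOp
  map_mul' _ _ := funext fun _ => map_mul tensorOp _ _

theorem tensorFamily_apply (F : ℕ → Matrix (Fin d) (Fin d) ℂ) (n : ℕ) :
    tensorFamily F n = tensorOp fun j => F j.val := rfl

/-- The building blocks of word families: local product operators and collective operators. -/
def letters (d : ℕ) : Set (OpFamily d) :=
  {X | ∃ F : ℕ → Matrix (Fin d) (Fin d) ℂ, F =ᶠ[atTop] 1 ∧ tensorFamily F = X} ∪
    Set.range fun A n => collectiveOp (n + 1) A

/-- The algebra of operator families that, on long chains, are built from local and collective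
operators. -/
noncomputable def wordFamilies (d : ℕ) : Subalgebra ℂ (OpFamily d) where
  carrier := {X | ∃ Y ∈ Algebra.adjoin ℂ (letters d), ∀ᶠ n in atTop, X n = Y n}
  add_mem' := by
    rintro X X' ⟨Y, hY, hX⟩ ⟨Y', hY', hX'⟩
    exact ⟨Y + Y', add_mem hY hY', by filter_upwards [hX, hX'] with n hn hn'; simp [hn, hn']⟩
  mul_mem' := by
    rintro X X' ⟨Y, hY, hX⟩ ⟨Y', hY', hX'⟩
    exact ⟨Y * Y', mul_mem hY hY', by filter_upwards [hX, hX'] with n hn hn'; simp [hn, hn']⟩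
  algebraMap_mem' c := ⟨_, Subalgebra.algebraMap_mem _ c, .of_forall fun _ => rfl⟩

theorem val_natCast_of_le {t n : ℕ} (ht : t ≤ n) : (t : ZMod (n + 1)).val = t :=
  ZMod.val_cast_of_lt (Nat.lt_succ_of_le ht)

theorem siteOp_natCast_eq_tensorFamily (A : Matrix (Fin d) (Fin d) ℂ) {t n : ℕ} (ht : t ≤ n) :
    siteOp (n + 1) A t = tensorFamily (Pi.mulSingle t A) n := by
  rw [siteOp_eq_tensorOp, tensorFamily_apply]
  congr 1
  ext j : 1
  by_cases hj : j = t
  · rw [hj, Pi.mulSingle_eq_same, val_natCast_of_le ht, Pi.mulSingle_eq_same]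
  · rw [Pi.mulSingle_eq_of_ne hj, Pi.mulSingle_eq_of_ne]
    rintro rfl
    exact hj (ZMod.natCast_zmod_val j).symm

theorem mulSingle_eventuallyEq_one (t : ℕ) (A : Matrix (Fin d) (Fin d) ℂ) :
    (Pi.mulSingle t A : ℕ → Matrix (Fin d) (Fin d) ℂ) =ᶠ[atTop] 1 := by
  filter_upwards [eventually_ne_atTop t] with j hj
  exact Pi.mulSingle_eq_of_ne (M := fun _ => Matrix (Fin d) (Fin d) ℂ) hj A

theorem mul_eventuallyEq_one {F F' : ℕ → Matrix (Fin d) (Fin d) ℂ} (hF : F =ᶠ[atTop] 1)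
    (hF' : F' =ᶠ[atTop] 1) : F * F' =ᶠ[atTop] 1 := by
  filter_upwards [hF, hF'] with j hj hj'
  rw [Pi.mul_apply, hj, hj', Pi.one_apply, one_mul]

theorem exists_permOp_tensorFamily_eq {F : ℕ → Matrix (Fin d) (Fin d) ℂ} (hF : F =ᶠ[atTop] 1) :
    ∃ s : ℕ, ∀ (n : ℕ) (π : Equiv.Perm (ZMod (n + 1))), (∀ j, j.val < s → π j = j) →
      permOp π (tensorFamily F n) = tensorFamily F n := by
  obtain ⟨s, hs⟩ := eventually_atTop.mp hF
  refine ⟨s, fun n π hπ => permOp_eq_self_of_mem_localAlgebra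
    (W := Finset.univ.filter fun j : ZMod (n + 1) => j.val < s) (by simpa using hπ)
    (tensorOp_mem_localAlgebra fun j hj => hs _ ?_)⟩
  simpa using hj

theorem exists_permOp_eq_of_mem_closure_letters {Y : OpFamily d}
    (hY : Y ∈ Submonoid.closure (letters d)) :
    ∃ s : ℕ, ∀ (n : ℕ) (π : Equiv.Perm (ZMod (n + 1))), (∀ j, j.val < s → π j = j) →
      permOp π (Y n) = Y n := by
  induction hY using Submonoid.closure_induction with
  | one => exact ⟨0, fun n π _ => map_one (permOp π)⟩
  | mul X Y _ _ hX hY =>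
    obtain ⟨s, hs⟩ := hX
    obtain ⟨s', hs'⟩ := hY
    refine ⟨max s s', fun n π hπ => ?_⟩
    rw [Pi.mul_apply, map_mul, hs n π fun j hj => hπ j (lt_max_of_lt_left hj),
      hs' n π fun j hj => hπ j (lt_max_of_lt_right hj)]
  | mem X hX =>
    rcases hX with ⟨F, hF, rfl⟩ | ⟨A, rfl⟩
    · exact exists_permOp_tensorFamily_eq hF
    · exact ⟨0, fun n π _ => permOp_collectiveOp π A⟩

theorem sum_zmod_eq_sum_range {M : Type*} [AddCommMonoid M] (n : ℕ) (f : ZMod (n + 1) → M) :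
    ∑ j, f j = ∑ t ∈ Finset.range (n + 1), f t := by
  rw [← Fin.sum_univ_eq_sum_range (fun t => f t)]
  exact Finset.sum_congr rfl fun j _ => congrArg f (ZMod.natCast_zmod_val (n := n + 1) j).symm

variable {ψ : Fin d → ℂ}

theorem productState_eq_tensorState (N : ℕ) [NeZero N] :
    productState N ψ = tensorState fun _ => ψ := rfl

theorem braket_tensorFamily_mem_eventuallyPoly (hψ : star ψ ⬝ᵥ ψ = 1)
    {F : ℕ → Matrix (Fin d) (Fin d) ℂ} (hF : F =ᶠ[atTop] 1) :
    (fun n => braket (productState (n + 1) ψ) (tensorFamily F n) (productState (n + 1) ψ)) ∈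
      eventuallyPoly := by
  obtain ⟨s, hs⟩ := eventually_atTop.mp hF
  refine mem_eventuallyPoly_congr (g := algebraMap ℂ _ (∏ t ∈ Finset.range s,
    (star ψ ⬝ᵥ (F t *ᵥ ψ)))) ?_ (eventuallyPoly.algebraMap_mem _)
  filter_upwards [eventually_ge_atTop s] with n hn
  rw [productState_eq_tensorState, tensorFamily_apply, braket_tensorState_tensorOp]
  refine (Fin.prod_univ_eq_prod_range (fun t => star ψ ⬝ᵥ (F t *ᵥ ψ)) (n + 1)).trans
    (Finset.prod_subset (Finset.range_subset_range.mpr (by omega)) fun t _ ht => ?_).symm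
  rw [hs t (by simpa using ht), Pi.one_apply, Matrix.one_mulVec, hψ]

theorem exists_braket_mul_siteOp_mul_eq (ψ : Fin d → ℂ) (A : Matrix (Fin d) (Fin d) ℂ)
    {F : ℕ → Matrix (Fin d) (Fin d) ℂ} (hF : F =ᶠ[atTop] 1) {Y : OpFamily d}
    (hY : Y ∈ Submonoid.closure (letters d)) :
    ∃ s : ℕ, ∀ n t : ℕ, s ≤ t → t ≤ n →
      braket (productState (n + 1) ψ) (tensorFamily F n * (siteOp (n + 1) A t * Y n))
        (productState (n + 1) ψ) =
      braket (productState (n + 1) ψ) (tensorFamily F n * (siteOp (n + 1) A s * Y n))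
        (productState (n + 1) ψ) := by
  obtain ⟨s, hs⟩ := exists_permOp_tensorFamily_eq hF
  obtain ⟨s', hs'⟩ := exists_permOp_eq_of_mem_closure_letters hY
  refine ⟨max s s', fun n t hst htn => ?_⟩
  have fixes : ∀ j : ZMod (n + 1), j.val < max s s' →
      Equiv.swap (t : ZMod (n + 1)) (max s s' : ℕ) j = j := fun j hj => by
    refine Equiv.swap_apply_of_ne_of_ne ?_ ?_ <;> rintro rfl <;>
      rw [val_natCast_of_le (by omega)] at hj <;> omega
  have symm := isSymm_tensorState_const (N := n + 1) ψ
  have swap := symm.braket_permOp symm (Equiv.swap (t : ZMod (n + 1)) (max s s' : ℕ))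
    (tensorFamily F n * (siteOp (n + 1) A t * Y n))
  rw [map_mul (permOp _), map_mul (permOp _), permOp_siteOp, Equiv.swap_apply_left,
    hs n _ fun j hj => fixes j (lt_max_of_lt_left hj),
    hs' n _ fun j hj => fixes j (lt_max_of_lt_right hj)] at swap
  exact swap.symm

/-- By permutation symmetry, only the first few sites of a collective operator contribute
differently, so each collective operator in a word raises the degree by at most one. -/
theorem braket_tensorFamily_mul_mem_eventuallyPoly (hψ : star ψ ⬝ᵥ ψ = 1) {Y : OpFamily d}
    (hY : Y ∈ Submonoid.closure (letters d)) {F : ℕ → Matrix (Fin d) (Fin d) ℂ}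
    (hF : F =ᶠ[atTop] 1) :
    (fun n => braket (productState (n + 1) ψ) (tensorFamily F n * Y n)
      (productState (n + 1) ψ)) ∈ eventuallyPoly := by
  induction hY using Submonoid.closure_induction_left generalizing F with
  | one => simpa only [Pi.one_apply, mul_one] using braket_tensorFamily_mem_eventuallyPoly hψ hF
  | mul_left X hX Y hY ih =>
    rcases hX with ⟨F', hF', rfl⟩ | ⟨A, rfl⟩
    · simpa only [map_mul, Pi.mul_apply, mul_assoc] using ih (mul_eventuallyEq_one hF hF')
    obtain ⟨s, hs⟩ := exists_braket_mul_siteOp_mul_eq ψ A hF hY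
    let g : ℕ → ℕ → ℂ := fun t n => braket (productState (n + 1) ψ)
      (tensorFamily F n * (siteOp (n + 1) A t * Y n)) (productState (n + 1) ψ)
    have hg : ∀ t, g t ∈ eventuallyPoly := fun t => by
      refine mem_eventuallyPoly_congr ?_
        (ih (mul_eventuallyEq_one hF (mulSingle_eventuallyEq_one t A)))
      filter_upwards [eventually_ge_atTop t] with n hn
      simp only [g, siteOp_natCast_eq_tensorFamily A hn, ← mul_assoc]
      rw [← Pi.mul_apply, ← map_mul]
    refine mem_eventuallyPoly_congr (.of_forall fun n => ?_)
      (sum_range_succ_mem_eventuallyPoly hg hs)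
    simp only [g, Pi.mul_apply, collectiveOp, Finset.sum_mul, Finset.mul_sum, map_sum,
      LinearMap.sum_apply, sum_zmod_eq_sum_range]

theorem braket_mem_eventuallyPoly (hψ : star ψ ⬝ᵥ ψ = 1) {X : OpFamily d}
    (hX : X ∈ wordFamilies d) :
    (fun n => braket (productState (n + 1) ψ) (X n) (productState (n + 1) ψ)) ∈
      eventuallyPoly := by
  obtain ⟨Y, hY, hXY⟩ := hX
  refine mem_eventuallyPoly_congr (g := fun n =>
    braket (productState (n + 1) ψ) (Y n) (productState (n + 1) ψ))
    (by filter_upwards [hXY] with n hn; rw [hn]) ?_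
  clear hXY
  rw [← Subalgebra.mem_toSubmodule, Algebra.adjoin_eq_span] at hY
  induction hY using Submodule.span_induction with
  | zero =>
    simpa only [Pi.zero_apply, map_zero, LinearMap.zero_apply] using! eventuallyPoly.zero_mem
  | add X Y _ _ hX hY =>
    simpa only [Pi.add_apply, map_add, LinearMap.add_apply] using! eventuallyPoly.add_mem hX hY
  | smul c X _ hX =>
    simpa only [Pi.smul_apply, map_smul, LinearMap.smul_apply] using! eventuallyPoly.smul_mem hX c
  | mem Y hY =>
    simpa only [map_one, Pi.one_apply, one_mul] using
      braket_tensorFamily_mul_mem_eventuallyPoly hψ hY (EventuallyEq.refl atTop 1)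

theorem siteOp_natCast_mem_wordFamilies (A : Matrix (Fin d) (Fin d) ℂ) (t : ℕ) :
    (fun n => siteOp (n + 1) A t) ∈ wordFamilies d := by
  refine ⟨_, Algebra.subset_adjoin (.inl ⟨_, mulSingle_eventuallyEq_one t A, rfl⟩), ?_⟩
  filter_upwards [eventually_ge_atTop t] with n hn
  exact siteOp_natCast_eq_tensorFamily A hn

theorem collectiveOp_mem_wordFamilies (A : Matrix (Fin d) (Fin d) ℂ) :
    (fun n => collectiveOp (n + 1) A) ∈ wordFamilies d :=
  ⟨_, Algebra.subset_adjoin (.inr ⟨A, rfl⟩), .of_forall fun _ => rfl⟩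

theorem extend_natCast {ι α : Type*} {φ : ι → ℕ} (hφ : Function.Injective φ) {n : ℕ}
    (hn : ∀ a, φ a ≤ n) (g : ι → α) (e : α) (j : ZMod (n + 1)) :
    Function.extend (fun a => (φ a : ZMod (n + 1))) g (fun _ => e) j =
      Function.extend φ g (fun _ => e) j.val := by
  have val_cast := fun a => val_natCast_of_le (hn a)
  have injective : Function.Injective fun a => (φ a : ZMod (n + 1)) := fun a b hab =>
    hφ (by rw [← val_cast a, ← val_cast b]; exact congrArg ZMod.val hab)
  by_cases hj : ∃ a, (φ a : ZMod (n + 1)) = j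
  · obtain ⟨a, rfl⟩ := hj
    rw [injective.extend_apply, val_cast, hφ.extend_apply]
  · rw [Function.extend_apply' _ _ _ hj, Function.extend_apply']
    rintro ⟨a, ha⟩
    exact hj ⟨a, by rw [ha, ZMod.natCast_zmod_val]⟩

/-- The block operators at a fixed place, on chains of every size. -/
noncomputable def blockFamily {m : ℕ} (h : Matrix (Fin (m + 1) → Fin d) (Fin (m + 1) → Fin d) ℂ)
    (l : ℕ) : OpFamily d :=
  fun n => blockOp (n + 1) h l

theorem blockFamily_mem_wordFamilies {m : ℕ}
    (h : Matrix (Fin (m + 1) → Fin d) (Fin (m + 1) → Fin d) ℂ) (l : ℕ) :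
    blockFamily h l ∈ wordFamilies d := by
  let φ : Fin (m + 1) → ℕ := fun a => l + a
  have hφ : Function.Injective φ := fun a b hab => Fin.ext (Nat.add_left_cancel hab)
  let F := fun s t : Fin (m + 1) → Fin d =>
    Function.extend φ (fun a => Matrix.single (s a) (t a) (1 : ℂ)) 1
  refine ⟨∑ s, ∑ t, h s t • tensorFamily (F s t), sum_mem fun s _ => sum_mem fun t _ =>
    Subalgebra.smul_mem _ (Algebra.subset_adjoin (.inl ⟨F s t, ?_, rfl⟩)) _, ?_⟩
  rotate_left
  · filter_upwards [eventually_gt_atTop (l + m)] with j hj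
    refine Function.extend_apply' _ _ _ ?_
    rintro ⟨a, rfl⟩
    exact absurd hj (by have := a.2; simp only [φ]; omega)
  · filter_upwards [eventually_ge_atTop (l + m)] with n hn
    rw [blockFamily, blockOp_eq_placedOp,
      placedOp_eq_sum_tensorOp (blockSites_injective (by omega) _)]
    simp only [Finset.sum_apply, Pi.smul_apply, tensorFamily_apply, F]
    refine Finset.sum_congr rfl fun s _ => Finset.sum_congr rfl fun t _ => ?_
    congr 2
    ext j : 1
    simp only [← Nat.cast_add]
    exact extend_natCast hφ (fun a => by have := a.2; simp only [φ]; omega) _ 1 j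

theorem conjTranspose_mem_wordFamilies {X : OpFamily d} (hX : X ∈ wordFamilies d) :
    (fun n => (X n)ᴴ) ∈ wordFamilies d := by
  have star_letters : star (letters d) ⊆ letters d := by
    rintro X (⟨F, hF, hX⟩ | ⟨A, hX⟩)
    · refine .inl ⟨fun j => (F j)ᴴ, ?_, ?_⟩
      · filter_upwards [hF] with j hj
        rw [hj, Pi.one_apply, Matrix.conjTranspose_one]
      · rw [← star_star X, ← hX]
        exact funext fun n => (tensorOp_conjTranspose _).symm
    · refine .inr ⟨Aᴴ, ?_⟩
      rw [← star_star X, ← hX]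
      exact funext fun n => (collectiveOp_conjTranspose A).symm
  obtain ⟨Y, hY, hXY⟩ := hX
  refine ⟨star Y, Algebra.adjoin_mono star_letters ?_, ?_⟩
  · rw [← Subalgebra.star_adjoin_comm]
    exact (Subalgebra.star_mem_star_iff _ _).mpr hY
  · filter_upwards [hXY] with n hn
    rw [hn]
    rfl

theorem exists_towerState_eq_mulVec (w : List (Matrix (Fin d) (Fin d) ℂ)) :
    ∃ Y ∈ wordFamilies d, ∀ (ψ : Fin d → ℂ) (n : ℕ),
      towerState (n + 1) ψ w = Y n *ᵥ productState (n + 1) ψ := by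
  induction w with
  | nil => exact ⟨1, one_mem _, fun ψ n => (Matrix.one_mulVec _).symm⟩
  | cons a w ih =>
    obtain ⟨Y, hY, h⟩ := ih
    refine ⟨_, mul_mem (collectiveOp_mem_wordFamilies a) hY, fun ψ n => ?_⟩
    rw [Pi.mul_apply, ← Matrix.mulVec_mulVec, ← h, towerState, List.foldr_cons, ← towerState]

theorem braket_siteDiff_mem_eventuallyPoly (hψ : star ψ ⬝ᵥ ψ = 1)
    (q : Matrix (Fin d) (Fin d) ℂ) (w : List (Matrix (Fin d) (Fin d) ℂ)) (r i j : ℕ)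
    {X : OpFamily d} (hX : X ∈ wordFamilies d) :
    (fun n => braket (siteDiff q (towerState (n + 1) ψ w) r i) (X n)
      (siteDiff q (towerState (n + 1) ψ w) r j)) ∈ eventuallyPoly := by
  obtain ⟨Y, hY, tower⟩ := exists_towerState_eq_mulVec w
  let D : ℕ → OpFamily d := fun j n => (siteOp (n + 1) q j - siteOp (n + 1) q r) * Y n
  have hD : ∀ j, D j ∈ wordFamilies d := fun j => mul_mem
    (sub_mem (siteOp_natCast_mem_wordFamilies q j) (siteOp_natCast_mem_wordFamilies q r)) hY
  have siteDiff_eq : ∀ (j n : ℕ), siteDiff q (towerState (n + 1) ψ w) r j =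
      D j n *ᵥ productState (n + 1) ψ := fun j n => by
    rw [tower, ← Matrix.mulVec_mulVec, Matrix.sub_mulVec, siteDiff]
  simp only [siteDiff_eq, braket_mulVec_left, ← braket_mul]
  exact braket_mem_eventuallyPoly hψ
    (mul_mem (conjTranspose_mem_wordFamilies (hD i)) (mul_mem hX (hD j)))

end Words

section Momentum

variable {N : ℕ} [NeZero N] {p : ℤ} {k : ℝ}

/-- The character `j ↦ e^{ikj}` of the chain at the momentum `k = 2πp/N`. -/
noncomputable def momentumChar (N : ℕ) [NeZero N] (p : ℤ) : AddChar (ZMod N) ℂ :=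
  ZMod.stdAddChar.mulShift (p : ZMod N)

theorem momentumChar_intCast (hk : k = 2 * Real.pi * p / N) (a : ℤ) :
    momentumChar N p (a : ZMod N) = Complex.exp (Complex.I * k * a) := by
  rw [momentumChar, AddChar.mulShift_apply, ← Int.cast_mul, ZMod.stdAddChar_coe, hk]
  push_cast
  ring_nf

theorem momentumChar_ne_one (hp : ¬(N : ℤ) ∣ p) : momentumChar N p ≠ 1 :=
  ZMod.isPrimitive_stdAddChar N (mt (ZMod.intCast_zmod_eq_zero_iff_dvd p N).mp hp)

/-- The excitation of momentum `2πp/N` on top of the tower state with label `w`. -/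
noncomputable abbrev modeState {d : ℕ} (N : ℕ) [NeZero N] (ψ : Fin d → ℂ)
    (q : Matrix (Fin d) (Fin d) ℂ) (w : List (Matrix (Fin d) (Fin d) ℂ)) (p : ℤ) : State d N :=
  twist (momentumChar N p) q (towerState N ψ w)

theorem twistedState_eq_modeState (hk : k = 2 * Real.pi * p / N) {d : ℕ} (ψ : Fin d → ℂ)
    (w : List (Matrix (Fin d) (Fin d) ℂ)) (q : Matrix (Fin d) (Fin d) ℂ) :
    twistedState N ψ w q k = modeState N ψ q w p := by
  rw [twistedState, twistedOp, modeState, twist, Matrix.sum_mulVec]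
  refine Finset.sum_congr rfl fun j _ => ?_
  rw [Matrix.smul_mulVec]
  congr 1
  simpa using (momentumChar_intCast (N := N) hk j.val).symm

end Momentum

section Blocks

variable {N m : ℕ} [NeZero N]

theorem sum_blockSet {M : Type*} [AddCommMonoid M] (hN : m + 1 ≤ N) (l : ZMod N)
    (F : ZMod N → M) : ∑ j ∈ blockSet N m l, F j = ∑ a : Fin (m + 1), F (l + (a : ℕ)) := by
  rw [blockSet, Finset.sum_image (blockSites_injective hN l).injOn]

theorem exists_perm_blocks (hN : m + 1 ≤ N) {l l' l'' r' r'' : ZMod N}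
    (hd : Disjoint (blockSet N m l) (blockSet N m l'))
    (hd' : Disjoint (blockSet N m l) (blockSet N m l''))
    (hr : r' ∉ blockSet N m l) (hr' : r' ∉ blockSet N m l')
    (hs : r'' ∉ blockSet N m l) (hs' : r'' ∉ blockSet N m l'') :
    ∃ π : Equiv.Perm (ZMod N), π r' = r'' ∧ (∀ a : Fin (m + 1), π (l + (a : ℕ)) = l + (a : ℕ)) ∧
      ∀ a : Fin (m + 1), π (l' + (a : ℕ)) = l'' + (a : ℕ) := by
  have injective : ∀ {l' r : ZMod N}, Disjoint (blockSet N m l) (blockSet N m l') →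
      r ∉ blockSet N m l → r ∉ blockSet N m l' →
      Function.Injective (Sum.elim (fun a : Fin (m + 1) => l + ((a : ℕ) : ZMod N))
        (Sum.elim (fun a : Fin (m + 1) => l' + ((a : ℕ) : ZMod N)) (fun _ : Unit => r))) := by
    intro l' r hd hr hr'
    refine (blockSites_injective hN l).sumElim ((blockSites_injective hN l').sumElim
      (fun _ _ _ => rfl) fun a _ ha => hr' (mem_blockSet.mpr ⟨a, ha⟩)) ?_
    rintro a (b | _) hab
    · exact Finset.disjoint_left.mp hd (mem_blockSet.mpr ⟨a, rfl⟩) (mem_blockSet.mpr ⟨b, hab.symm⟩)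
    · exact hr (mem_blockSet.mpr ⟨a, hab⟩)
  obtain ⟨π, hπ⟩ := Equiv.Perm.exists_extending_pair _ _ (injective hd hr hr')
    (injective hd' hs hs')
  exact ⟨π, hπ (.inr (.inr ())), fun a => hπ (.inl a), fun a => hπ (.inr (.inl a))⟩

theorem natCast_mem_blockSet {l j : ℕ} (hl : l + m < N) (hj : j < N) :
    (j : ZMod N) ∈ blockSet N m l ↔ l ≤ j ∧ j ≤ l + m := by
  rw [mem_blockSet]
  constructor
  · rintro ⟨a, ha⟩
    have : l + a = j := CharP.natCast_injOn_Iio (ZMod N) N (Set.mem_Iio.mpr (by omega)) hj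
      (by exact_mod_cast ha)
    omega
  · rintro ⟨hlj, hjl⟩
    exact ⟨⟨j - l, by omega⟩, by rw [← Nat.cast_add, Nat.add_sub_cancel' hlj]⟩

theorem blockSet_subset_blockSet {l l' m' : ℕ} (hl : l' ≤ l) (hm : l + m ≤ l' + m') :
    blockSet N m l ⊆ blockSet N m' l' := by
  intro j hj
  obtain ⟨a, rfl⟩ := mem_blockSet.mp hj
  refine mem_blockSet.mpr ⟨⟨l - l' + a, by omega⟩, ?_⟩
  rw [← Nat.cast_add, ← Nat.cast_add]
  congr 1
  simp only
  omega

theorem disjoint_blockSet_natCast {l l' : ℕ} (h : l + m < l') (h' : l' + m < N) :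
    Disjoint (blockSet N m (l : ZMod N)) (blockSet N m (l' : ZMod N)) := by
  rw [Finset.disjoint_left]
  intro j hj hj'
  obtain ⟨a, rfl⟩ := mem_blockSet.mp hj
  rw [← Nat.cast_add] at hj'
  have := (natCast_mem_blockSet h' (by omega)).mp hj'
  omega

theorem disjoint_blockSet_of_notMem {l t : ZMod N} (ht : t ∉ blockSet N (2 * m) (l - m)) :
    Disjoint (blockSet N m l) (blockSet N m t) := by
  rw [Finset.disjoint_left]
  intro j hj hj'
  obtain ⟨a, ha⟩ := mem_blockSet.mp hj
  obtain ⟨b, hb⟩ := mem_blockSet.mp hj'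
  refine ht (mem_blockSet.mpr ⟨⟨m + a - b, by omega⟩, ?_⟩)
  rw [Nat.cast_sub (by omega), Nat.cast_add, eq_sub_of_add_eq (hb.trans ha.symm)]
  ring

theorem exists_notMem_blockSets (hN : 2 * m + 3 ≤ N) (l l' : ZMod N) :
    ∃ r, r ∉ blockSet N m l ∧ r ∉ blockSet N m l' := by
  simp only [← not_or, ← Finset.mem_union]
  refine Finset.exists_mem_notMem_of_card_lt_card (t := Finset.univ) ?_ |>.imp fun r hr => hr.2
  refine (Finset.card_union_le _ _).trans_lt ?_
  rw [card_blockSet (by omega), card_blockSet (by omega), Finset.card_univ, ZMod.card]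
  omega

end Blocks

section Moments

variable {d N m : ℕ} [NeZero N] {G : Type*} [Group G] {u : G →* Matrix.unitaryGroup (Fin d) ℂ}
  {ψ : Fin d → ℂ} {q : Matrix (Fin d) (Fin d) ℂ} {Ψ : State d N} {χ : AddChar (ZMod N) ℂ}
  {h : Matrix (Fin (m + 1) → Fin d) (Fin (m + 1) → Fin d) ℂ} {l l' r : ZMod N}

theorem IsSymm.braket_twist_hamiltonian (hΨ : IsSymm Ψ) (l : ZMod N) :
    braket (twist χ q Ψ) (hamiltonian N h) (twist χ q Ψ) =
      N * braket (twist χ q Ψ) (blockOp N h l) (twist χ q Ψ) := by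
  have translate : ∀ t, braket (twist χ q Ψ) (blockOp N h t) (twist χ q Ψ) =
      braket (twist χ q Ψ) (blockOp N h l) (twist χ q Ψ) := fun t => by
    rw [← hΨ.braket_twist_permOp_addRight q (blockOp N h l) (t - l), permOp_addRight_blockOp,
      add_sub_cancel]
  simp only [hamiltonian, map_sum, LinearMap.sum_apply, translate, Finset.sum_const,
    Finset.card_univ, ZMod.card, nsmul_eq_mul]

theorem IsSymm.braket_twist_hamiltonian_sq (hΨ : IsSymm Ψ) (l : ZMod N) :
    braket (twist χ q Ψ) (hamiltonian N h * hamiltonian N h) (twist χ q Ψ) =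
      N * ∑ t, braket (twist χ q Ψ) (blockOp N h l * blockOp N h t) (twist χ q Ψ) := by
  have translate : ∀ t, braket (twist χ q Ψ) (blockOp N h t * hamiltonian N h) (twist χ q Ψ) =
      braket (twist χ q Ψ) (blockOp N h l * hamiltonian N h) (twist χ q Ψ) := fun t => by
    rw [← hΨ.braket_twist_permOp_addRight q (blockOp N h l * hamiltonian N h) (t - l),
      map_mul (permOp _), permOp_addRight_blockOp, permOp_addRight_hamiltonian, add_sub_cancel]
  have expand : hamiltonian N h * hamiltonian N h = ∑ t, blockOp N h t * hamiltonian N h := by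
    rw [← Finset.sum_mul, ← hamiltonian]
  simp only [expand, map_sum, LinearMap.sum_apply, translate, Finset.sum_const,
    Finset.card_univ, ZMod.card, nsmul_eq_mul]
  rw [hamiltonian, Finset.mul_sum, map_sum, LinearMap.sum_apply]

/-- The correlation of two blocks at `l` and `t` in a twisted state, with the overlaps of the
differences evaluated at a reference pair of blocks `l`, `l'` that carries the operator `X`. -/
noncomputable def blockCorrelation (m : ℕ) (χ : AddChar (ZMod N) ℂ) (q : Matrix (Fin d) (Fin d) ℂ)
    (Ψ : State d N) (X : Op d N) (l l' r t : ZMod N) : ℂ :=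
  ∑ a : Fin (m + 1), ∑ b : Fin (m + 1),
    (χ (t + (b : ℕ) - (l + (a : ℕ))) *
        braket (siteDiff q Ψ r (l + (a : ℕ))) X (siteDiff q Ψ r (l' + (b : ℕ))) +
      χ (l + (a : ℕ) - (t + (b : ℕ))) *
        braket (siteDiff q Ψ r (l' + (b : ℕ))) X (siteDiff q Ψ r (l + (a : ℕ))))

theorem sum_blockCorrelation_eq_zero (hχ : χ ≠ 1) (X : Op d N) :
    ∑ t, blockCorrelation m χ q Ψ X l l' r t = 0 := by
  have sum_right : ∀ b c, ∑ t, χ (t + b - c) = 0 := fun b c =>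
    (((Equiv.addRight b).trans (Equiv.subRight c)).sum_comp χ).trans
      (AddChar.sum_eq_zero_of_ne_one hχ)
  have sum_left : ∀ b c, ∑ t, χ (c - (t + b)) = 0 := fun b c =>
    (((Equiv.addRight b).trans (Equiv.subLeft c)).sum_comp χ).trans
      (AddChar.sum_eq_zero_of_ne_one hχ)
  simp only [blockCorrelation]
  rw [Finset.sum_comm]
  refine Finset.sum_eq_zero fun a _ => ?_
  rw [Finset.sum_comm]
  refine Finset.sum_eq_zero fun b _ => ?_
  simp only [Finset.sum_add_distrib, ← Finset.sum_mul, sum_right, sum_left, zero_mul, add_zero]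

theorem nullOn_blockOp_mul (hψ : star ψ ⬝ᵥ ψ = 1) (hN : m + 2 ≤ N)
    (hscar : ∀ Φ ∈ scarSpace u ψ N, hamiltonian N h *ᵥ Φ = 0)
    (hd : Disjoint (blockSet N m l) (blockSet N m l')) :
    NullOn u ψ (blockSet N m l) (blockOp N h l * blockOp N h l') ∧
      NullOn u ψ (blockSet N m l') (blockOp N h l * blockOp N h l') := by
  have hloc := blockOp_mem_localAlgebra (N := N) (by omega) h
  refine ⟨(nullOn_blockOp hψ hN hscar l).mul_of_disjoint (hloc l') hd.symm, ?_⟩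
  rw [commute_of_mem_localAlgebra hd (hloc l) (hloc l')]
  exact (nullOn_blockOp hψ hN hscar l').mul_of_disjoint (hloc l) hd

theorem braket_twist_blockOp_mul_eq (hψ : star ψ ⬝ᵥ ψ = 1) (hN : 2 * m + 3 ≤ N)
    (hscar : ∀ Φ ∈ scarSpace u ψ N, hamiltonian N h *ᵥ Φ = 0) (hχ : χ ≠ 1)
    (hΨ : Ψ ∈ scarSpace u ψ N) (hd : Disjoint (blockSet N m l) (blockSet N m l'))
    (hr : r ∉ blockSet N m l) (hr' : r ∉ blockSet N m l') {t : ZMod N}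
    (ht : Disjoint (blockSet N m l) (blockSet N m t)) :
    braket (twist χ q Ψ) (blockOp N h l * blockOp N h t) (twist χ q Ψ) =
      blockCorrelation m χ q Ψ (blockOp N h l * blockOp N h l') l l' r t := by
  have hN' : m + 1 ≤ N := by omega
  have hloc := blockOp_mem_localAlgebra hN' h
  obtain ⟨s, hs, hs'⟩ := exists_notMem_blockSets hN l t
  obtain ⟨hnull, hnull'⟩ := nullOn_blockOp_mul hψ (by omega) hscar ht
  obtain ⟨π, hπs, hπl, hπt⟩ := exists_perm_blocks hN' ht hd hs hs' hr hr'
  have hπX : permOp π (blockOp N h l * blockOp N h t) = blockOp N h l * blockOp N h l' := by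
    simp only [map_mul, blockOp_eq_placedOp, permOp_placedOp, Function.comp_def, hπl, hπt]
  have move := (isSymm_of_mem_scarSpace hΨ).braket_siteDiff_perm q π
    (blockOp N h l * blockOp N h t) s
  rw [hnull.braket_twist_union_eq hnull' (mul_mem (localAlgebra_mono Finset.subset_union_left
    (hloc l)) (localAlgebra_mono Finset.subset_union_right (hloc t))) ht hχ hΨ hs hs']
  simp only [sum_blockSet hN', blockCorrelation, ← move, hπX, hπs, hπl, hπt]

theorem sum_braket_twist_blockOp_mul_eq (hψ : star ψ ⬝ᵥ ψ = 1) (hN : 2 * m + 3 ≤ N)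
    (hscar : ∀ Φ ∈ scarSpace u ψ N, hamiltonian N h *ᵥ Φ = 0) (hχ : χ ≠ 1)
    (hΨ : Ψ ∈ scarSpace u ψ N) (hd : Disjoint (blockSet N m l) (blockSet N m l'))
    (hr : r ∉ blockSet N m l) (hr' : r ∉ blockSet N m l') {near : Finset (ZMod N)}
    (hnear : ∀ t ∉ near, Disjoint (blockSet N m l) (blockSet N m t)) :
    ∑ t, braket (twist χ q Ψ) (blockOp N h l * blockOp N h t) (twist χ q Ψ) =
      braket (twist χ q Ψ) (∑ t ∈ near, blockOp N h l * blockOp N h t) (twist χ q Ψ) -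
        ∑ t ∈ near, blockCorrelation m χ q Ψ (blockOp N h l * blockOp N h l') l l' r t := by
  have far : ∑ t ∈ nearᶜ, braket (twist χ q Ψ) (blockOp N h l * blockOp N h t) (twist χ q Ψ) =
      ∑ t ∈ nearᶜ, blockCorrelation m χ q Ψ (blockOp N h l * blockOp N h l') l l' r t :=
    Finset.sum_congr rfl fun t ht => braket_twist_blockOp_mul_eq hψ hN hscar hχ hΨ hd hr hr'
      (hnear t (Finset.mem_compl.mp ht))
  have total := sum_blockCorrelation_eq_zero (m := m) (q := q) (Ψ := Ψ) (l := l) (l' := l')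
    (r := r) hχ (blockOp N h l * blockOp N h l')
  rw [← Finset.sum_add_sum_compl near] at total
  rw [← Finset.sum_add_sum_compl near, far, eq_neg_of_add_eq_zero_right total, map_sum,
    LinearMap.sum_apply, sub_eq_add_neg]

theorem sum_braket_siteDiff_blockOp_mul (hψ : star ψ ⬝ᵥ ψ = 1) (hN : m + 2 ≤ N)
    (hscar : ∀ Φ ∈ scarSpace u ψ N, hamiltonian N h *ᵥ Φ = 0) (hq : q ∈ complexGenerators u)
    (hΨ : Ψ ∈ scarSpace u ψ N) (hd : Disjoint (blockSet N m l) (blockSet N m l'))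
    (hr' : r ∉ blockSet N m l') :
    (∑ i ∈ blockSet N m l, ∑ j ∈ blockSet N m l',
      braket (siteDiff q Ψ r i) (blockOp N h l * blockOp N h l') (siteDiff q Ψ r j) = 0) ∧
    ∑ i ∈ blockSet N m l, ∑ j ∈ blockSet N m l',
      braket (siteDiff q Ψ r j) (blockOp N h l * blockOp N h l') (siteDiff q Ψ r i) = 0 := by
  obtain ⟨-, hnull⟩ := nullOn_blockOp_mul hψ hN hscar hd
  have mem := fun i (hi : i ∈ blockSet N m l) =>
    siteDiff_mem_partialScar q hΨ hr' (Finset.disjoint_left.mp hd hi)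
  exact ⟨Finset.sum_eq_zero fun i hi => hnull.sum_braket_siteDiff_right hq hΨ hr' (mem i hi),
    Finset.sum_eq_zero fun i hi => hnull.sum_braket_siteDiff_left hq hΨ hr' (mem i hi)⟩

end Moments

section Bands

open Filter Topology BoundedContinuousFunction
open scoped NNReal

variable {α R : Type*} [NormedRing R]

theorem lipschitzWith_mul_of_norm_le {f g : ℝ →ᵇ R} {K K' : ℝ≥0} (hfK : ‖f‖ ≤ K)
    (hf : LipschitzWith K f) (hgK : ‖g‖ ≤ K') (hg : LipschitzWith K' g) :
    LipschitzWith (K * K' + K * K') (f * g) := by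
  refine LipschitzWith.of_dist_le_mul fun x y => ?_
  rw [dist_eq_norm]
  calc ‖f x * g x - f y * g y‖ = ‖f x * (g x - g y) + (f x - f y) * g y‖ := by noncomm_ring
    _ ≤ K * (K' * dist x y) + K * dist x y * K' := by
        refine norm_add_le_of_le (norm_mul_le_of_le ((f.norm_coe_le_norm x).trans hfK) ?_)
          (norm_mul_le_of_le ?_ ((g.norm_coe_le_norm y).trans hgK))
        · exact dist_eq_norm (g x) (g y) ▸ hg.dist_le_mul x y
        · exact dist_eq_norm (f x) (f y) ▸ hf.dist_le_mul x y
    _ = ↑(K * K' + K * K') * dist x y := by push_cast; ring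

/-- Size-dependent bands: for every size `n` and every label `w : α` a bounded continuous function
of the momentum that vanishes at momentum zero. The bounds and Lipschitz constants are uniform in
the label for large `n`, and for a fixed label the functions converge uniformly as `n → ∞`. -/
def bandFamilies (α R : Type*) [NormedRing R] : NonUnitalSubring (ℕ → α → (ℝ →ᵇ R)) where
  carrier := {F | (∃ K : ℝ≥0, ∀ᶠ n in atTop, ∀ w, ‖F n w‖ ≤ K ∧ LipschitzWith K (F n w)) ∧
    (∀ᶠ n in atTop, ∀ w, F n w 0 = 0) ∧ ∀ w, ∃ L, Tendsto (F · w) atTop (𝓝 L)}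
  zero_mem' := ⟨⟨0, by simp⟩, by simp, fun _ => ⟨0, tendsto_const_nhds⟩⟩
  add_mem' := by
    rintro F F' ⟨⟨K, hK⟩, hF, hL⟩ ⟨⟨K', hK'⟩, hF', hL'⟩
    refine ⟨⟨K + K', ?_⟩, ?_, fun w => ?_⟩
    · filter_upwards [hK, hK'] with n h h' w
      exact ⟨norm_add_le_of_le (h w).1 (h' w).1, (h w).2.add (h' w).2⟩
    · filter_upwards [hF, hF'] with n h h' w
      simp [h w, h' w]
    · obtain ⟨⟨L, h⟩, L', h'⟩ := And.intro (hL w) (hL' w)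
      exact ⟨L + L', h.add h'⟩
  neg_mem' := by
    rintro F ⟨⟨K, hK⟩, hF, hL⟩
    refine ⟨⟨K, ?_⟩, ?_, fun w => (hL w).imp' _ fun _ => Tendsto.neg⟩
    · filter_upwards [hK] with n h w
      exact ⟨(norm_neg _).trans_le (h w).1, (h w).2.neg⟩
    · filter_upwards [hF] with n h w
      simp [h w]
  mul_mem' := by
    rintro F F' ⟨⟨K, hK⟩, hF, hL⟩ ⟨⟨K', hK'⟩, -, hL'⟩
    refine ⟨⟨K * K' + K * K', ?_⟩, ?_, fun w => ?_⟩
    · filter_upwards [hK, hK'] with n h h' w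
      refine ⟨(norm_mul_le_of_le (h w).1 (h' w).1).trans ?_,
        lipschitzWith_mul_of_norm_le (h w).1 (h w).2 (h' w).1 (h' w).2⟩
      exact_mod_cast le_self_add
    · filter_upwards [hF] with n h w
      simp [h w]
    · obtain ⟨⟨L, h⟩, L', h'⟩ := And.intro (hL w) (hL' w)
      exact ⟨L * L', h.mul h'⟩

theorem lipschitzWith_innerProbChar (θ : ℝ) : LipschitzWith ‖θ‖₊ (innerProbChar θ) := by
  refine LipschitzWith.of_dist_le_mul fun x y => ?_
  have factor : innerProbChar θ x - innerProbChar θ y =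
      innerProbChar θ y * (Complex.exp (Complex.I * ((x - y) * θ : ℝ)) - 1) := by
    rw [mul_sub, mul_one, innerProbChar_apply, innerProbChar_apply, ← Complex.exp_add]
    congr 2
    simp
    ring
  have unimodular : ‖innerProbChar θ y‖ = 1 := by
    rw [innerProbChar_apply, Complex.norm_exp_ofReal_mul_I]
  rw [dist_eq_norm, factor, norm_mul, unimodular, one_mul, coe_nnnorm, dist_eq_norm, ← norm_mul,
    mul_comm θ]
  exact Real.norm_exp_I_mul_ofReal_sub_one_le

theorem smul_innerProbChar_sub_one_mem_bandFamilies {c : ℕ → α → ℂ} {C : ℝ≥0}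
    (hC : ∀ᶠ n in atTop, ∀ w, ‖c n w‖ ≤ C) (hc : ∀ w, ∃ L, Tendsto (c · w) atTop (𝓝 L)) (θ : ℝ) :
    (fun n w => c n w • (innerProbChar θ - 1)) ∈ bandFamilies α ℂ := by
  set χ : ℝ →ᵇ ℂ := innerProbChar θ - 1
  have hχ : LipschitzWith ‖θ‖₊ χ := LipschitzWith.of_dist_le_mul fun x y =>
    (dist_sub_right _ _ (1 : ℂ)).trans_le ((lipschitzWith_innerProbChar θ).dist_le_mul x y)
  refine ⟨⟨C * (‖χ‖₊ + ‖θ‖₊), ?_⟩, ?_, fun w => ?_⟩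
  · filter_upwards [hC] with n h w
    constructor
    · rw [norm_smul]
      push_cast
      gcongr
      · exact h w
      · simp
    · exact ((lipschitzWith_smul (c n w)).comp hχ).weaken (mul_le_mul' (h w) le_add_self)
  · simp [χ, innerProbChar_apply]
  · obtain ⟨L, h⟩ := hc w
    exact ⟨L • χ, h.smul_const χ⟩

theorem re_mem_bandFamilies {F : ℕ → α → (ℝ →ᵇ ℂ)} (hF : F ∈ bandFamilies α ℂ) :
    (fun n w => Complex.reCLM.compLeftContinuousBounded ℝ (F n w)) ∈ bandFamilies α ℝ := by
  obtain ⟨⟨K, hK⟩, hF, hL⟩ := hF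
  refine ⟨⟨K, ?_⟩, ?_, fun w => ?_⟩
  · filter_upwards [hK] with n h w
    refine ⟨(norm_le K.2).mpr fun x => ?_, ?_⟩
    · exact (Complex.abs_re_le_norm _).trans (((F n w).norm_coe_le_norm x).trans (h w).1)
    · refine LipschitzWith.of_dist_le_mul fun x y => le_trans ?_ ((h w).2.dist_le_mul x y)
      rw [dist_eq_norm, dist_eq_norm]
      exact Complex.abs_re_le_norm (F n w x - F n w y)
  · filter_upwards [hF] with n h w
    simp [h w]
  · obtain ⟨L, h⟩ := hL w
    exact ⟨_, ((Complex.reCLM.compLeftContinuousBounded ℝ).continuous.tendsto L).comp h⟩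

variable {F : ℕ → α → (ℝ →ᵇ ℝ)}

theorem exists_limit_of_mem_bandFamilies (hF : F ∈ bandFamilies α ℝ) (w : α) :
    ∃ g : ℝ → ℝ, Continuous g ∧ Tendsto g (𝓝 0) (𝓝 0) ∧
      ∀ η > 0, ∀ᶠ n in atTop, ∀ k, |F n w k - g k| < η := by
  obtain ⟨-, hF, hL⟩ := hF
  obtain ⟨L, hL⟩ := hL w
  have hL₀ : L 0 = 0 := tendsto_nhds_unique
    ((tendsto_iff_tendstoUniformly.mp hL).tendsto_at 0)
    (tendsto_const_nhds.congr' (hF.mono fun n h => (h w).symm))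
  refine ⟨L, L.continuous, by simpa only [hL₀] using L.continuous.tendsto 0, fun η hη => ?_⟩
  filter_upwards [Metric.tendsto_nhds.mp hL η hη] with n h k
  exact (dist_coe_le_dist k).trans_lt h

theorem exists_modulus_of_mem_bandFamilies (hF : F ∈ bandFamilies α ℝ) {η : ℝ} (hη : 0 < η) :
    ∃ δ > 0, ∀ᶠ n in atTop, ∀ w k, (∀ k', |k - k'| < δ → |F n w k - F n w k'| < η) ∧
      (|k| < δ → |F n w k| < η) := by
  obtain ⟨⟨K, hK⟩, hF, -⟩ := hF
  refine ⟨η / (K + 1), by positivity, ?_⟩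
  filter_upwards [hK, hF] with n hK hF w k
  have close : ∀ k', |k - k'| < η / (K + 1) → |F n w k - F n w k'| < η := fun k' hk => by
    rw [lt_div_iff₀ (by positivity)] at hk
    have := (hK w).2.dist_le_mul k k'
    rw [Real.dist_eq, Real.dist_eq] at this
    nlinarith [abs_nonneg (k - k')]
  exact ⟨close, fun hk => by simpa [hF w] using close 0 (by rwa [sub_zero])⟩

end Bands

section MomentumBands

open Filter Topology BoundedContinuousFunction
open scoped NNReal

variable {α R : Type*} [NormedRing R] {x : ℕ → α → ℤ → R}

/-- Quantities that depend on a size `n`, a label `w : α` and a momentum number `p`, and that on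
long chains of `n + 1` sites are the values of a family of bands at the nonzero momenta
`2πp/(n + 1)`. -/
def momentumBands (α R : Type*) [NormedRing R] : NonUnitalSubring (ℕ → α → ℤ → R) where
  carrier := {x | ∃ F ∈ bandFamilies α R, ∀ᶠ n in atTop, ∀ w (p : ℤ), ¬((n + 1 : ℕ) : ℤ) ∣ p →
    x n w p = F n w (2 * Real.pi * p / (n + 1 : ℕ))}
  zero_mem' := ⟨0, zero_mem _, by simp⟩
  add_mem' := by
    rintro x x' ⟨F, hF, hx⟩ ⟨F', hF', hx'⟩
    refine ⟨F + F', add_mem hF hF', ?_⟩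
    filter_upwards [hx, hx'] with n h h' w p hp
    simp only [Pi.add_apply, BoundedContinuousFunction.add_apply, h w p hp, h' w p hp]
  neg_mem' := by
    rintro x ⟨F, hF, hx⟩
    refine ⟨-F, neg_mem hF, ?_⟩
    filter_upwards [hx] with n h w p hp
    simp only [Pi.neg_apply, BoundedContinuousFunction.neg_apply, h w p hp]
  mul_mem' := by
    rintro x x' ⟨F, hF, hx⟩ ⟨F', hF', hx'⟩
    refine ⟨F * F', mul_mem hF hF', ?_⟩
    filter_upwards [hx, hx'] with n h h' w p hp
    simp only [Pi.mul_apply, BoundedContinuousFunction.mul_apply, h w p hp, h' w p hp]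

theorem mem_momentumBands_congr {y : ℕ → α → ℤ → R}
    (h : ∀ᶠ n in atTop, ∀ w (p : ℤ), ¬((n + 1 : ℕ) : ℤ) ∣ p → x n w p = y n w p)
    (hy : y ∈ momentumBands α R) : x ∈ momentumBands α R := by
  obtain ⟨F, hF, hy⟩ := hy
  refine ⟨F, hF, ?_⟩
  filter_upwards [h, hy] with n h hy w p hp
  rw [h w p hp, hy w p hp]

theorem re_mem_momentumBands {x : ℕ → α → ℤ → ℂ} (hx : x ∈ momentumBands α ℂ) :
    (fun n w p => (x n w p).re) ∈ momentumBands α ℝ := by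
  obtain ⟨F, hF, hx⟩ := hx
  refine ⟨_, re_mem_bandFamilies hF, ?_⟩
  filter_upwards [hx] with n h w p hp
  exact congrArg Complex.re (h w p hp)

/-- As the coefficients sum to zero, each phase `e^{ikθ}` may be replaced by `e^{ikθ} - 1`, which
vanishes at momentum zero. -/
theorem sum_momentumChar_mul_mem_momentumBands {ι : Type*} [Fintype ι] (θ : ι → ℤ)
    {c : ι → ℕ → α → ℂ} {C : ℝ≥0} (hC : ∀ s, ∀ᶠ n in atTop, ∀ w, ‖c s n w‖ ≤ C)
    (hc : ∀ s w, ∃ L, Tendsto (c s · w) atTop (𝓝 L))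
    (hsum : ∀ᶠ n in atTop, ∀ w, ∑ s, c s n w = 0) :
    (fun n w p => ∑ s, momentumChar (n + 1) p (θ s) * c s n w) ∈ momentumBands α ℂ := by
  refine ⟨_, sum_mem fun s (_ : s ∈ Finset.univ) =>
    smul_innerProbChar_sub_one_mem_bandFamilies (hC s) (hc s) (θ s), ?_⟩
  filter_upwards [hsum] with n h w p _
  have phase : ∀ s, momentumChar (n + 1) p (θ s) =
      innerProbChar (θ s : ℝ) (2 * Real.pi * p / (n + 1 : ℕ)) := fun s => by
    rw [momentumChar_intCast rfl, innerProbChar_apply]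
    congr 1
    simp
    ring
  simp only [phase, Finset.sum_apply, coe_sum, coe_smul, coe_sub, coe_one, Pi.sub_apply,
    Pi.one_apply, smul_eq_mul, mul_sub, mul_one, Finset.sum_sub_distrib, h w, sub_zero]
  exact Finset.sum_congr rfl fun s _ => mul_comm _ _

theorem exists_limit_of_mem_momentumBands {x : ℕ → α → ℤ → ℝ} (hx : x ∈ momentumBands α ℝ)
    (w : α) : ∃ g : ℝ → ℝ, Continuous g ∧ Tendsto g (𝓝 0) (𝓝 0) ∧
      ∀ η > 0, ∀ᶠ n in atTop, ∀ p : ℤ, ¬((n + 1 : ℕ) : ℤ) ∣ p →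
        |x n w p - g (2 * Real.pi * p / (n + 1 : ℕ))| < η := by
  obtain ⟨F, hF, hx⟩ := hx
  obtain ⟨g, hg, hg₀, limit⟩ := exists_limit_of_mem_bandFamilies hF w
  refine ⟨g, hg, hg₀, fun η hη => ?_⟩
  filter_upwards [hx, limit η hη] with n hx limit p hp
  rw [hx w p hp]
  exact limit _

theorem exists_modulus_of_mem_momentumBands {x : ℕ → α → ℤ → ℝ} (hx : x ∈ momentumBands α ℝ)
    {η : ℝ} (hη : 0 < η) : ∃ δ > 0, ∀ᶠ n in atTop, ∀ w (p : ℤ), ¬((n + 1 : ℕ) : ℤ) ∣ p →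
      (∀ p' : ℤ, ¬((n + 1 : ℕ) : ℤ) ∣ p' →
        |2 * Real.pi * p / (n + 1 : ℕ) - 2 * Real.pi * p' / (n + 1 : ℕ)| < δ →
        |x n w p - x n w p'| < η) ∧
      (|2 * Real.pi * p / (n + 1 : ℕ)| < δ → |x n w p| < η) := by
  obtain ⟨F, hF, hx⟩ := hx
  obtain ⟨δ, hδ, modulus⟩ := exists_modulus_of_mem_bandFamilies hF hη
  refine ⟨δ, hδ, ?_⟩
  filter_upwards [hx, modulus] with n hx modulus w p hp
  rw [hx w p hp]
  exact ⟨fun p' hp' => hx w p' hp' ▸ (modulus w _).1 _, (modulus w _).2⟩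

end MomentumBands

section SiteCoeff

open scoped Matrix.Norms.L2Operator

variable {d N : ℕ} [NeZero N] (q : Matrix (Fin d) (Fin d) ℂ) {Ψ : State d N}

theorem expectation_eq_braket_div (A : Op d N) (Ψ : State d N) :
    expectation N A Ψ = braket Ψ A Ψ / braket Ψ 1 Ψ := by
  rw [braket_apply, braket_one, expectation]

/-- The overlap `⟨Dᵢ, X Dⱼ⟩` of the differences `Dⱼ = (qⱼ - qᵣ) Ψ`, in units of the squared norm
per site of a twisted state. -/
noncomputable def siteCoeff (X : Op d N) (Ψ : State d N) (r i j : ZMod N) : ℂ :=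
  2 * (braket (siteDiff q Ψ r i) X (siteDiff q Ψ r j) /
    braket (siteDiff q Ψ r 0) 1 (siteDiff q Ψ r 0))

theorem IsSymm.natCast_mul_braket_siteDiff_div (hΨ : IsSymm Ψ) {χ : AddChar (ZMod N) ℂ}
    (hχ : χ ≠ 1) {r : ZMod N} (hr : 0 ≠ r) (X : Op d N) (i j : ZMod N) :
    N * (braket (siteDiff q Ψ r i) X (siteDiff q Ψ r j) /
      braket (twist χ q Ψ) 1 (twist χ q Ψ)) = siteCoeff q X Ψ r i j := by
  have hN : (N : ℂ) ≠ 0 := Nat.cast_ne_zero.mpr (NeZero.ne N)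
  rw [hΨ.braket_twist_self q hχ hr, siteCoeff]
  field_simp

theorem IsSymm.norm_siteCoeff_le (hΨ : IsSymm Ψ) (X : Op d N) {r i j : ZMod N} (hr : 0 ≠ r)
    (hi : i ≠ r) (hj : j ≠ r) : ‖siteCoeff q X Ψ r i j‖ ≤ 2 * ‖X‖ := by
  rw [siteCoeff, norm_mul, norm_div, Complex.norm_two]
  gcongr
  refine div_le_of_le_mul₀ (norm_nonneg _) (norm_nonneg _) (norm_braket_le_of_braket_one_eq X ?_ ?_)
  · exact hΨ.braket_siteDiff_self_eq q hi hr
  · exact hΨ.braket_siteDiff_self_eq q hj hr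

end SiteCoeff

section Expectations

open Filter Topology
open scoped NNReal Matrix.Norms.L2Operator

variable {d m : ℕ} {G : Type*} [Group G] {u : G →* Matrix.unitaryGroup (Fin d) ℂ}
  {ψ : Fin d → ℂ} {q : Matrix (Fin d) (Fin d) ℂ} {X : OpFamily d}

/-- The labels of tower states, as words in the complexified generators. -/
abbrev Label (u : G →* Matrix.unitaryGroup (Fin d) ℂ) : Type :=
  {w : List (Matrix (Fin d) (Fin d) ℂ) // ∀ a ∈ w, a ∈ complexGenerators u}

/-- The word families whose operator norms stay bounded on long chains. -/
def boundedWordFamilies (d : ℕ) : NonUnitalSubring (OpFamily d) where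
  carrier := {X ∈ wordFamilies d | ∃ C : ℝ≥0, ∀ᶠ n in atTop, ‖X n‖ ≤ C}
  zero_mem' := ⟨zero_mem _, 0, by simp⟩
  add_mem' := by
    rintro X X' ⟨hX, C, hC⟩ ⟨hX', C', hC'⟩
    refine ⟨add_mem hX hX', C + C', ?_⟩
    filter_upwards [hC, hC'] with n h h'
    exact norm_add_le_of_le h h'
  neg_mem' := by
    rintro X ⟨hX, C, hC⟩
    refine ⟨neg_mem hX, C, ?_⟩
    filter_upwards [hC] with n h
    exact (norm_neg _).trans_le h
  mul_mem' := by
    rintro X X' ⟨hX, C, hC⟩ ⟨hX', C', hC'⟩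
    refine ⟨mul_mem hX hX', C * C', ?_⟩
    filter_upwards [hC, hC'] with n h h'
    exact norm_mul_le_of_le h h'

theorem mem_boundedWordFamilies : X ∈ boundedWordFamilies d ↔
    X ∈ wordFamilies d ∧ ∃ C : ℝ≥0, ∀ᶠ n in atTop, ‖X n‖ ≤ C :=
  Iff.rfl

theorem blockFamily_mem_boundedWordFamilies
    (h : Matrix (Fin (m + 1) → Fin d) (Fin (m + 1) → Fin d) ℂ) (l : ℕ) :
    blockFamily h l ∈ boundedWordFamilies d := by
  refine mem_boundedWordFamilies.mpr ⟨blockFamily_mem_wordFamilies h l, ∑ s, ∑ t, ‖h s t‖₊, ?_⟩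
  filter_upwards [eventually_ge_atTop m] with n hn
  push_cast
  exact norm_blockOp_le (Nat.succ_le_succ hn) h l

theorem isSymm_towerState {w : List (Matrix (Fin d) (Fin d) ℂ)}
    (hw : ∀ a ∈ w, a ∈ complexGenerators u) (N : ℕ) [NeZero N] : IsSymm (towerState N ψ w) :=
  isSymm_of_mem_scarSpace (towerState_mem_scarSpace hw)

theorem natCast_ne_natCast_of_lt {i r n : ℕ} (hi : i < r) (hr : r ≤ n) :
    (i : ZMod (n + 1)) ≠ r := fun h =>
  hi.ne (CharP.natCast_injOn_Iio (ZMod (n + 1)) (n + 1) (Set.mem_Iio.mpr (by omega))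
    (Set.mem_Iio.mpr (by omega)) h)

theorem eventually_norm_siteCoeff_le {C : ℝ≥0} (hC : ∀ᶠ n in atTop, ‖X n‖ ≤ C) {r i j : ℕ}
    (hi : i < r) (hj : j < r) : ∀ᶠ n in atTop, ∀ w : Label u,
      ‖siteCoeff q (X n) (towerState (n + 1) ψ w.1) r i j‖ ≤ (2 * C : ℝ≥0) := by
  filter_upwards [hC, eventually_ge_atTop r] with n hC hn w
  have hr : (0 : ZMod (n + 1)) ≠ r := by
    simpa using natCast_ne_natCast_of_lt (show 0 < r by omega) hn
  refine ((isSymm_towerState w.2 (n + 1)).norm_siteCoeff_le q (X n) hr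
    (natCast_ne_natCast_of_lt hi hn) (natCast_ne_natCast_of_lt hj hn)).trans ?_
  push_cast
  gcongr

theorem exists_tendsto_siteCoeff (hψ : star ψ ⬝ᵥ ψ = 1) (hX : X ∈ boundedWordFamilies d)
    {r i j : ℕ} (hi : i < r) (hj : j < r) (w : Label u) :
    ∃ L, Tendsto (fun n => siteCoeff q (X n) (towerState (n + 1) ψ w.1) r i j) atTop (𝓝 L) := by
  obtain ⟨hX, C, hC⟩ := mem_boundedWordFamilies.mp hX
  have hone := braket_siteDiff_mem_eventuallyPoly hψ q w.1 r 0 0 (one_mem (wordFamilies d))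
  obtain ⟨L, hL⟩ := exists_tendsto_div_of_mem_eventuallyPoly
    (braket_siteDiff_mem_eventuallyPoly hψ q w.1 r i j hX) hone (C := C) <| by
    filter_upwards [hC, eventually_ge_atTop r] with n hC hn
    have hsymm := isSymm_towerState (ψ := ψ) w.2 (n + 1)
    have h₀ := natCast_ne_natCast_of_lt (show 0 < r by omega) hn
    refine (norm_braket_le_of_braket_one_eq (X n)
      (hsymm.braket_siteDiff_self_eq q (natCast_ne_natCast_of_lt hi hn) h₀)
      (hsymm.braket_siteDiff_self_eq q (natCast_ne_natCast_of_lt hj hn) h₀)).trans ?_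
    exact mul_le_mul_of_nonneg_right hC (norm_nonneg _)
  refine ⟨2 * L, (hL.const_mul 2).congr fun n => ?_⟩
  simp only [siteCoeff, Nat.cast_zero, Pi.one_apply]

theorem sum_momentumChar_mul_siteCoeff_mem_momentumBands (hψ : star ψ ⬝ᵥ ψ = 1)
    (hX : X ∈ boundedWordFamilies d) {ι : Type*} [Fintype ι] (θ : ι → ℤ) {r : ℕ} {i j : ι → ℕ}
    (hi : ∀ s, i s < r) (hj : ∀ s, j s < r)
    (hsum : ∀ᶠ n in atTop, ∀ w : Label u,
      ∑ s, siteCoeff q (X n) (towerState (n + 1) ψ w.1) r (i s) (j s) = 0) :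
    (fun n (w : Label u) p => ∑ s, momentumChar (n + 1) p (θ s) *
      siteCoeff q (X n) (towerState (n + 1) ψ w.1) r (i s) (j s)) ∈ momentumBands (Label u) ℂ := by
  obtain ⟨-, C, hC⟩ := mem_boundedWordFamilies.mp hX
  exact sum_momentumChar_mul_mem_momentumBands θ
    (fun s => eventually_norm_siteCoeff_le hC (hi s) (hj s))
    (fun s w => exists_tendsto_siteCoeff hψ hX (hi s) (hj s) w) hsum

theorem sum_momentumChar_mul_braket_mem_momentumBands (hψ : star ψ ⬝ᵥ ψ = 1)
    (hX : X ∈ boundedWordFamilies d) {ι : Type*} [Fintype ι] (θ : ι → ℤ) {r : ℕ} (hr : 0 < r)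
    {i j : ι → ℕ} (hi : ∀ s, i s < r) (hj : ∀ s, j s < r)
    (hsum : ∀ᶠ n in atTop, ∀ w : Label u,
      ∑ s, braket (siteDiff q (towerState (n + 1) ψ w.1) r (i s)) (X n)
        (siteDiff q (towerState (n + 1) ψ w.1) r (j s)) = 0) :
    (fun n (w : Label u) p => ((n + 1 : ℕ) : ℂ) *
      ((∑ s, momentumChar (n + 1) p (θ s) *
        braket (siteDiff q (towerState (n + 1) ψ w.1) r (i s)) (X n)
          (siteDiff q (towerState (n + 1) ψ w.1) r (j s))) /
        braket (modeState (n + 1) ψ q w.1 p) 1 (modeState (n + 1) ψ q w.1 p))) ∈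
      momentumBands (Label u) ℂ := by
  have coeffs : ∀ᶠ n in atTop, ∀ w : Label u,
      ∑ s, siteCoeff q (X n) (towerState (n + 1) ψ w.1) r (i s) (j s) = 0 := by
    filter_upwards [hsum] with n h w
    simp only [siteCoeff, ← Finset.mul_sum, ← Finset.sum_div, h w, zero_div, mul_zero]
  refine mem_momentumBands_congr ?_
    (sum_momentumChar_mul_siteCoeff_mem_momentumBands hψ hX θ hi hj coeffs)
  filter_upwards [eventually_ge_atTop r] with n hn w p hp
  have h₀ : (0 : ZMod (n + 1)) ≠ r := by simpa using natCast_ne_natCast_of_lt hr hn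
  rw [Finset.sum_div, Finset.mul_sum]
  refine Finset.sum_congr rfl fun s _ => ?_
  rw [← (isSymm_towerState w.2 (n + 1)).natCast_mul_braket_siteDiff_div q
    (momentumChar_ne_one hp) h₀, mul_div_assoc]
  ring

theorem natCast_mul_expectation_mem_momentumBands (hψ : star ψ ⬝ᵥ ψ = 1)
    (hq : q ∈ complexGenerators u) (hX : X ∈ boundedWordFamilies d) {M : ℕ}
    (hloc : ∀ᶠ n in atTop, X n ∈ localAlgebra d (blockSet (n + 1) M 0))
    (hnull : ∀ᶠ n in atTop, NullOn u ψ (blockSet (n + 1) M 0) (X n)) :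
    (fun n (w : Label u) p => ((n + 1 : ℕ) : ℂ) *
      expectation (n + 1) (X n) (modeState (n + 1) ψ q w.1 p)) ∈ momentumBands (Label u) ℂ := by
  have free : ∀ᶠ n : ℕ in atTop, ((M + 1 : ℕ) : ZMod (n + 1)) ∉ blockSet (n + 1) M 0 := by
    filter_upwards [eventually_ge_atTop (M + 1)] with n hn h
    have := natCast_mem_blockSet (N := n + 1) (m := M) (l := 0) (j := M + 1) (by omega) (by omega)
    rw [Nat.cast_zero] at this
    exact absurd (this.mp h).2 (by omega)
  have sums : ∀ᶠ n in atTop, ∀ w : Label u, ∑ s : Fin (M + 1) × Fin (M + 1),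
      braket (siteDiff q (towerState (n + 1) ψ w.1) (M + 1 : ℕ) (s.1 : ℕ)) (X n)
        (siteDiff q (towerState (n + 1) ψ w.1) (M + 1 : ℕ) (s.2 : ℕ)) = 0 := by
    filter_upwards [eventually_ge_atTop M, free, hnull] with n hn hr hnull w
    rw [Fintype.sum_prod_type]
    simpa only [sum_blockSet (Nat.succ_le_succ hn), zero_add] using
      hnull.sum_sum_braket_siteDiff hq (towerState_mem_scarSpace w.2) hr
  refine mem_momentumBands_congr ?_ (sum_momentumChar_mul_braket_mem_momentumBands
    (i := fun s : Fin (M + 1) × Fin (M + 1) => s.1) (j := fun s => s.2) hψ hX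
    (fun s => (s.2 : ℕ) - (s.1 : ℕ)) M.succ_pos (fun s => s.1.2) (fun s => s.2.2) sums)
  filter_upwards [eventually_ge_atTop M, free, hloc, hnull] with n hn hr hloc hnull w p hp
  rw [expectation_eq_braket_div, hnull.braket_twist_eq hloc (momentumChar_ne_one hp)
    (towerState_mem_scarSpace w.2) hr, Fintype.sum_prod_type]
  simp only [sum_blockSet (Nat.succ_le_succ hn), zero_add, Int.cast_sub, Int.cast_natCast]

end Expectations

section NearBlocks

variable {d N m : ℕ} [NeZero N] {G : Type*} [Group G] {u : G →* Matrix.unitaryGroup (Fin d) ℂ}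
  {ψ : Fin d → ℂ} {h : Matrix (Fin (m + 1) → Fin d) (Fin (m + 1) → Fin d) ℂ}

/-- The part of `h_m H` in which the two blocks may overlap: the sum of `h_m hₜ` over
`0 ≤ t ≤ 2m`. -/
noncomputable def nearFamily (h : Matrix (Fin (m + 1) → Fin d) (Fin (m + 1) → Fin d) ℂ) :
    OpFamily d :=
  ∑ t : Fin (2 * m + 1), blockFamily h m * blockFamily h t

theorem nearFamily_mem_boundedWordFamilies
    (h : Matrix (Fin (m + 1) → Fin d) (Fin (m + 1) → Fin d) ℂ) :
    nearFamily h ∈ boundedWordFamilies d :=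
  sum_mem fun t _ => mul_mem (blockFamily_mem_boundedWordFamilies h m)
    (blockFamily_mem_boundedWordFamilies h t)

theorem nearFamily_apply {n : ℕ} (hn : 2 * m ≤ n)
    (h : Matrix (Fin (m + 1) → Fin d) (Fin (m + 1) → Fin d) ℂ) :
    nearFamily h n = ∑ t ∈ blockSet (n + 1) (2 * m) 0,
      blockOp (n + 1) h (m : ZMod (n + 1)) * blockOp (n + 1) h t := by
  simp only [nearFamily, sum_blockSet (Nat.succ_le_succ hn), zero_add, Finset.sum_apply,
    Pi.mul_apply, blockFamily]

theorem blockSet_natCast_subset_blockSet_zero {l m M : ℕ} (hM : l + m ≤ M) :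
    blockSet N m (l : ZMod N) ⊆ blockSet N M 0 := by
  simpa using blockSet_subset_blockSet (N := N) (l' := 0) l.zero_le (hM.trans_eq M.zero_add.symm)

theorem natCast_mem_blockSet_zero {M j : ℕ} (hM : M < N) (hj : j < N) :
    (j : ZMod N) ∈ blockSet N M 0 ↔ j ≤ M := by
  simpa using natCast_mem_blockSet (l := 0) (M.zero_add.trans_lt hM) hj

theorem exists_natCast_of_mem_blockSet_zero {M : ℕ} {t : ZMod N} (ht : t ∈ blockSet N M 0) :
    ∃ s ≤ M, (s : ZMod N) = t := by
  obtain ⟨a, rfl⟩ := mem_blockSet.mp ht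
  exact ⟨a, Nat.le_of_lt_succ a.2, (zero_add _).symm⟩

theorem disjoint_blockSet_natCast_self_of_notMem {t : ZMod N} (ht : t ∉ blockSet N (2 * m) 0) :
    Disjoint (blockSet N m (m : ZMod N)) (blockSet N m t) :=
  disjoint_blockSet_of_notMem (by rwa [sub_self])

theorem nearFamily_mem_localAlgebra {n : ℕ} (hn : 3 * m + 2 ≤ n) :
    nearFamily h n ∈ localAlgebra d (blockSet (n + 1) (3 * m + 1) 0) := by
  have hloc : ∀ t : ℕ, t ≤ 2 * m →
      blockOp (n + 1) h (t : ZMod (n + 1)) ∈ localAlgebra d (blockSet (n + 1) (3 * m + 1) 0) :=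
    fun t ht => localAlgebra_mono (blockSet_natCast_subset_blockSet_zero (by omega))
      (blockOp_mem_localAlgebra (by omega) h _)
  rw [nearFamily_apply (by omega)]
  refine sum_mem fun t ht => ?_
  obtain ⟨t, ht', rfl⟩ := exists_natCast_of_mem_blockSet_zero ht
  exact mul_mem (hloc m (by omega)) (hloc t ht')

theorem nullOn_nearFamily (hψ : star ψ ⬝ᵥ ψ = 1) {n : ℕ} (hn : 3 * m + 2 ≤ n)
    (hscar : ∀ Φ ∈ scarSpace u ψ (n + 1), hamiltonian (n + 1) h *ᵥ Φ = 0) :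
    NullOn u ψ (blockSet (n + 1) (3 * m + 1) 0) (nearFamily h n) := by
  have far : ∀ l : ℕ, l ≤ 2 * m →
      ((3 * m + 1 : ℕ) : ZMod (n + 1)) ∉ blockSet (n + 1) m (l : ZMod (n + 1)) := fun l hl => by
    rw [natCast_mem_blockSet (by omega) (by omega)]
    omega
  rw [nearFamily_apply (by omega)]
  refine nullOn_sum_blockOp_mul hψ (by omega) hscar m
    (fun t ht => (disjoint_blockSet_natCast_self_of_notMem ht).symm)
    (blockSet_natCast_subset_blockSet_zero (by omega)) (fun t ht => ?_)
    ((natCast_mem_blockSet_zero (by omega) (by omega)).mpr le_rfl) (far m (by omega))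
    (fun t ht => ?_)
  all_goals obtain ⟨t, ht', rfl⟩ := exists_natCast_of_mem_blockSet_zero ht
  · exact blockSet_natCast_subset_blockSet_zero (by omega)
  · exact far t ht'

end NearBlocks

section EnergyBands

open Filter

variable {d m : ℕ} {G : Type*} [Group G] {u : G →* Matrix.unitaryGroup (Fin d) ℂ}
  {ψ : Fin d → ℂ} {q : Matrix (Fin d) (Fin d) ℂ}
  {h : Matrix (Fin (m + 1) → Fin d) (Fin (m + 1) → Fin d) ℂ}

theorem expectation_hamiltonian_mem_momentumBands (hψ : star ψ ⬝ᵥ ψ = 1)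
    (hscar : ∀ᶠ n in atTop, ∀ Φ ∈ scarSpace u ψ (n + 1), hamiltonian (n + 1) h *ᵥ Φ = 0)
    (hq : q ∈ complexGenerators u) :
    (fun n (w : Label u) p => expectation (n + 1) (hamiltonian (n + 1) h)
      (modeState (n + 1) ψ q w.1 p)) ∈ momentumBands (Label u) ℂ := by
  have local_term : ∀ᶠ n in atTop,
      blockFamily h 0 n ∈ localAlgebra d (blockSet (n + 1) m 0) := by
    filter_upwards [eventually_ge_atTop m] with n hn
    simpa [blockFamily] using blockOp_mem_localAlgebra (Nat.succ_le_succ hn) h 0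
  have null_term : ∀ᶠ n in atTop, NullOn u ψ (blockSet (n + 1) m 0) (blockFamily h 0 n) := by
    filter_upwards [eventually_ge_atTop (m + 1), hscar] with n hn hscar
    simpa [blockFamily] using nullOn_blockOp hψ (Nat.succ_le_succ hn) hscar 0
  refine mem_momentumBands_congr (Eventually.of_forall fun n w p _ => ?_)
    (natCast_mul_expectation_mem_momentumBands hψ hq (blockFamily_mem_boundedWordFamilies h 0)
      local_term null_term)
  rw [expectation_eq_braket_div, expectation_eq_braket_div,
    (isSymm_towerState w.2 _).braket_twist_hamiltonian 0, blockFamily, mul_div_assoc,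
    Nat.cast_zero]

theorem eventually_sum_braket_siteDiff_blockFamily_mul (hψ : star ψ ⬝ᵥ ψ = 1)
    (hscar : ∀ᶠ n in atTop, ∀ Φ ∈ scarSpace u ψ (n + 1), hamiltonian (n + 1) h *ᵥ Φ = 0)
    (hq : q ∈ complexGenerators u) {l l' r : ℕ} (hl : l + m < l') (hr : l' + m < r) :
    ∀ᶠ n in atTop, ∀ w : Label u,
      (∑ s : Fin (m + 1) × Fin (m + 1),
        braket (siteDiff q (towerState (n + 1) ψ w.1) r (l + s.1 : ℕ))
          ((blockFamily h l * blockFamily h l') n)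
          (siteDiff q (towerState (n + 1) ψ w.1) r (l' + s.2 : ℕ)) = 0) ∧
      ∑ s : Fin (m + 1) × Fin (m + 1),
        braket (siteDiff q (towerState (n + 1) ψ w.1) r (l' + s.2 : ℕ))
          ((blockFamily h l * blockFamily h l') n)
          (siteDiff q (towerState (n + 1) ψ w.1) r (l + s.1 : ℕ)) = 0 := by
  filter_upwards [eventually_ge_atTop r, hscar] with n hn hscar w
  have hr' : (r : ZMod (n + 1)) ∉ blockSet (n + 1) m (l' : ZMod (n + 1)) := by
    rw [natCast_mem_blockSet (by omega) (by omega)]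
    omega
  simpa only [sum_blockSet (show m + 1 ≤ n + 1 by omega), Fintype.sum_prod_type, Nat.cast_add,
    Pi.mul_apply, blockFamily] using sum_braket_siteDiff_blockOp_mul hψ (by omega) hscar hq
      (towerState_mem_scarSpace w.2) (disjoint_blockSet_natCast hl (by omega)) hr'

theorem blockCorrelation_mem_momentumBands (hψ : star ψ ⬝ᵥ ψ = 1)
    (hscar : ∀ᶠ n in atTop, ∀ Φ ∈ scarSpace u ψ (n + 1), hamiltonian (n + 1) h *ᵥ Φ = 0)
    (hq : q ∈ complexGenerators u) {l l' r : ℕ} (hl : l + m < l') (hr : l' + m < r) (t : ℕ) :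
    (fun n (w : Label u) p => ((n + 1 : ℕ) : ℂ) *
      (blockCorrelation m (momentumChar (n + 1) p) q (towerState (n + 1) ψ w.1)
        (blockFamily h l n * blockFamily h l' n) l l' r t /
        braket (modeState (n + 1) ψ q w.1 p) 1 (modeState (n + 1) ψ q w.1 p))) ∈
      momentumBands (Label u) ℂ := by
  have hX : blockFamily h l * blockFamily h l' ∈ boundedWordFamilies d :=
    mul_mem (blockFamily_mem_boundedWordFamilies h l) (blockFamily_mem_boundedWordFamilies h l')
  have zero_sums := eventually_sum_braket_siteDiff_blockFamily_mul hψ hscar hq hl hr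
  have right := sum_momentumChar_mul_braket_mem_momentumBands hψ hX
    (i := fun s : Fin (m + 1) × Fin (m + 1) => l + s.1) (j := fun s => l' + s.2)
    (fun s => (t + s.2 : ℕ) - (l + s.1 : ℕ)) (r := r) (by omega) (fun s => by omega)
    (fun s => by omega) (zero_sums.mono fun n h w => (h w).1)
  have left := sum_momentumChar_mul_braket_mem_momentumBands hψ hX
    (i := fun s : Fin (m + 1) × Fin (m + 1) => l' + s.2) (j := fun s => l + s.1)
    (fun s => (l + s.1 : ℕ) - (t + s.2 : ℕ)) (r := r) (by omega) (fun s => by omega)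
    (fun s => by omega) (zero_sums.mono fun n h w => (h w).2)
  refine mem_momentumBands_congr (Eventually.of_forall fun n w p _ => ?_) (add_mem right left)
  simp only [blockCorrelation, Pi.add_apply, Pi.mul_apply, Finset.sum_add_distrib, add_div, mul_add,
    Fintype.sum_prod_type, Int.cast_sub, Int.cast_add, Int.cast_natCast, Nat.cast_add]

theorem expectation_hamiltonian_sq_mem_momentumBands (hψ : star ψ ⬝ᵥ ψ = 1)
    (hscar : ∀ᶠ n in atTop, ∀ Φ ∈ scarSpace u ψ (n + 1), hamiltonian (n + 1) h *ᵥ Φ = 0)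
    (hq : q ∈ complexGenerators u) :
    (fun n (w : Label u) p => expectation (n + 1)
      (hamiltonian (n + 1) h * hamiltonian (n + 1) h) (modeState (n + 1) ψ q w.1 p)) ∈
      momentumBands (Label u) ℂ := by
  have near := natCast_mul_expectation_mem_momentumBands hψ hq
    (nearFamily_mem_boundedWordFamilies h)
    ((eventually_ge_atTop (3 * m + 2)).mono fun n hn => nearFamily_mem_localAlgebra hn)
    (((eventually_ge_atTop (3 * m + 2)).and hscar).mono fun n hn => nullOn_nearFamily hψ hn.1 hn.2)
  have correlations := sum_mem fun (t : Fin (2 * m + 1)) (_ : t ∈ Finset.univ) =>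
    blockCorrelation_mem_momentumBands (l := m) (l' := 2 * m + 1) (r := 3 * m + 2) hψ hscar hq
      (by omega) (by omega) t
  refine mem_momentumBands_congr ?_ (sub_mem near correlations)
  filter_upwards [eventually_ge_atTop (3 * m + 2), hscar] with n hn hscar w p hp
  have far : ∀ l : ℕ, l ≤ 2 * m + 1 →
      ((3 * m + 2 : ℕ) : ZMod (n + 1)) ∉ blockSet (n + 1) m (l : ZMod (n + 1)) := fun l hl => by
    rw [natCast_mem_blockSet (by omega) (by omega)]
    omega
  rw [expectation_eq_braket_div, (isSymm_towerState w.2 _).braket_twist_hamiltonian_sq m,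
    sum_braket_twist_blockOp_mul_eq hψ (by omega) hscar (momentumChar_ne_one hp)
      (towerState_mem_scarSpace w.2) (disjoint_blockSet_natCast (l' := 2 * m + 1) (by omega)
        (by omega)) (far m (by omega)) (far _ le_rfl)
      fun t ht => disjoint_blockSet_natCast_self_of_notMem ht,
    ← nearFamily_apply (by omega), sum_blockSet (by omega), mul_div_assoc, sub_div, mul_sub]
  simp only [Pi.sub_apply, Finset.sum_apply, expectation_eq_braket_div, zero_add, Finset.sum_div,
    Finset.mul_sum, blockFamily]

end EnergyBands

section GroundEnergy

variable {d N m : ℕ} [NeZero N] {ψ : Fin d → ℂ}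
  {h : Matrix (Fin (m + 1) → Fin d) (Fin (m + 1) → Fin d) ℂ}

/-- The energy density `⟨ψ ⊗ ⋯ ⊗ ψ, h (ψ ⊗ ⋯ ⊗ ψ)⟩` of the product state, computed on the
`m + 1` sites of one local term. -/
noncomputable def anchorEnergy (h : Matrix (Fin (m + 1) → Fin d) (Fin (m + 1) → Fin d) ℂ)
    (ψ : Fin d → ℂ) : ℂ :=
  braket (fun s => ∏ a, ψ (s a)) h (fun s => ∏ a, ψ (s a))

theorem braket_productState_blockOp (hψ : star ψ ⬝ᵥ ψ = 1) (hN : m + 1 ≤ N) (l : ZMod N) :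
    braket (productState N ψ) (blockOp N h l) (productState N ψ) = anchorEnergy h ψ := by
  have entry : ∀ s t : Fin (m + 1) → Fin d,
      braket (productState N ψ) (tensorOp (Function.extend
        (fun a : Fin (m + 1) => l + ((a : ℕ) : ZMod N)) (fun a => Matrix.single (s a) (t a) 1) 1))
        (productState N ψ) = ∏ a, star (ψ (s a)) * ψ (t a) := fun s t => by
    rw [productState_eq_tensorState, braket_tensorState_tensorOp]
    refine (Fintype.prod_of_injective _ (blockSites_injective hN l) _ _ (fun j hj => ?_)
      fun a => ?_).symm
    · rw [Function.extend_apply' _ _ _ hj, Pi.one_apply, Matrix.one_mulVec, hψ]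
    · rw [(blockSites_injective hN l).extend_apply, Matrix.single_mulVec]
      simp [dotProduct, Function.update_apply]
  rw [blockOp_eq_placedOp, placedOp_eq_sum_tensorOp (blockSites_injective hN l)]
  simp only [map_sum, map_smul, LinearMap.sum_apply, LinearMap.smul_apply, entry, anchorEnergy,
    braket_apply, dotProduct, Matrix.mulVec, Pi.star_apply, star_prod, Finset.mul_sum,
    Finset.prod_mul_distrib, smul_eq_mul]
  exact Finset.sum_congr rfl fun s _ => Finset.sum_congr rfl fun t _ => mul_left_comm _ _ _

theorem eq_natCast_mul_anchorEnergy (hψ : star ψ ⬝ᵥ ψ = 1) (hN : m + 1 ≤ N) {E : ℂ}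
    (hE : hamiltonian N h *ᵥ productState N ψ = E • productState N ψ) :
    E = N * anchorEnergy h ψ := by
  have unit : star (productState N ψ) ⬝ᵥ productState N ψ = 1 := by
    rw [productState_eq_tensorState, star_tensorState_dotProduct, hψ, Finset.prod_const_one]
  calc E = braket (productState N ψ) (hamiltonian N h) (productState N ψ) := by
        rw [braket_apply, hE, dotProduct_smul, unit, smul_eq_mul, mul_one]
    _ = N * anchorEnergy h ψ := by
        simp only [hamiltonian, map_sum, LinearMap.sum_apply, braket_productState_blockOp hψ hN,
          Finset.sum_const, Finset.card_univ, ZMod.card, nsmul_eq_mul]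

theorem hamiltonian_sub_smul_one (h : Matrix (Fin (m + 1) → Fin d) (Fin (m + 1) → Fin d) ℂ)
    (c : ℂ) : hamiltonian N (h - c • 1) = hamiltonian N h - (N * c) • (1 : Op d N) := by
  simp only [hamiltonian, blockOp_eq_placedOp, map_sub, map_smul, placedOp_one,
    Finset.sum_sub_distrib, Finset.sum_const, Finset.card_univ, ZMod.card]
  rw [mul_smul, Nat.cast_smul_eq_nsmul]

end GroundEnergy

section EnergyShift

variable {d N : ℕ} [NeZero N] {H H' : Op d N} {Ψ : State d N} {E : ℝ}

open scoped ComplexOrder in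
theorem expectation_one (hΨ : Ψ ≠ 0) : expectation N 1 Ψ = 1 := by
  rw [expectation, Matrix.one_mulVec, div_self (dotProduct_star_self_eq_zero.not.mpr hΨ)]

theorem energy_sub_eq (hH : H = H' + (E : ℂ) • 1) (hΨ : Ψ ≠ 0) :
    energy N H Ψ - E = (expectation N H' Ψ).re := by
  have split : expectation N H Ψ = expectation N H' Ψ + E * expectation N 1 Ψ := by
    simp only [expectation_eq_braket_div, hH, map_add, map_smul, LinearMap.add_apply,
      LinearMap.smul_apply, smul_eq_mul, add_div, mul_div_assoc]
  rw [energy, split, expectation_one hΨ, mul_one, Complex.add_re, Complex.ofReal_re,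
    add_sub_cancel_right]

theorem energyVariance_eq (hH : H = H' + (E : ℂ) • 1) (hΨ : Ψ ≠ 0) :
    energyVariance N H Ψ =
      (expectation N (H' * H') Ψ).re - (expectation N H' Ψ).re * (expectation N H' Ψ).re := by
  set e := (expectation N H' Ψ).re with he
  have centre : H - (energy N H Ψ : ℂ) • (1 : Op d N) = H' - (e : ℂ) • 1 := by
    rw [eq_add_of_sub_eq (energy_sub_eq hH hΨ), hH, Complex.ofReal_add, add_smul]
    abel
  have square : (H' - (e : ℂ) • (1 : Op d N)) ^ 2 =
      H' * H' - (2 * e : ℂ) • H' + (e ^ 2 : ℂ) • 1 := by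
    rw [sq, sub_mul, mul_sub, mul_sub]
    simp only [mul_smul_comm, smul_mul_assoc, mul_one, one_mul, smul_smul]
    module
  have split : expectation N ((H' - (e : ℂ) • (1 : Op d N)) ^ 2) Ψ =
      expectation N (H' * H') Ψ - 2 * e * expectation N H' Ψ + e ^ 2 * expectation N 1 Ψ := by
    simp only [expectation_eq_braket_div, square, map_add, map_sub, map_smul, LinearMap.add_apply,
      LinearMap.sub_apply, LinearMap.smul_apply, smul_eq_mul, add_div, sub_div, mul_div_assoc]
  rw [energyVariance, centre, split, expectation_one hΨ]
  simp [← he, sq]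
  ring

end EnergyShift

section Asymptotics

open Filter

theorem exists_energy_bands {d m : ℕ} {G : Type*} [Group G]
    {u : G →* Matrix.unitaryGroup (Fin d) ℂ} {ψ : Fin d → ℂ} (hψ : star ψ ⬝ᵥ ψ = 1)
    {h : Matrix (Fin (m + 1) → Fin d) (Fin (m + 1) → Fin d) ℂ} {N₁ : ℕ} {E₀ : ℕ → ℝ}
    (hscar : ∀ (N : ℕ) [NeZero N], N₁ ≤ N → ∀ Ψ ∈ scarSpace u ψ N,
      hamiltonian N h *ᵥ Ψ = (E₀ N : ℂ) • Ψ)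
    {q : Matrix (Fin d) (Fin d) ℂ} (hq : q ∈ complexGenerators u) :
    ∃ x ∈ momentumBands (Label u) ℝ, ∃ y ∈ momentumBands (Label u) ℝ,
      ∀ᶠ n in atTop, ∀ (w : Label u) (p : ℤ),
        twistedState (n + 1) ψ w.1 q (2 * Real.pi * p / (n + 1 : ℕ)) ≠ 0 →
        energy (n + 1) (hamiltonian (n + 1) h)
          (twistedState (n + 1) ψ w.1 q (2 * Real.pi * p / (n + 1 : ℕ))) - E₀ (n + 1) = x n w p ∧
        energyVariance (n + 1) (hamiltonian (n + 1) h)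
          (twistedState (n + 1) ψ w.1 q (2 * Real.pi * p / (n + 1 : ℕ))) = y n w p := by
  set h' := h - anchorEnergy h ψ • (1 : Matrix (Fin (m + 1) → Fin d) (Fin (m + 1) → Fin d) ℂ)
  have shift : ∀ᶠ n in atTop, N₁ ≤ n + 1 ∧
      hamiltonian (n + 1) h = hamiltonian (n + 1) h' + (E₀ (n + 1) : ℂ) • 1 := by
    filter_upwards [eventually_ge_atTop (N₁ + m)] with n hn
    refine ⟨by omega, ?_⟩
    rw [eq_natCast_mul_anchorEnergy hψ (by omega)
      (hscar (n + 1) (by omega) _ productState_mem_scarSpace), hamiltonian_sub_smul_one,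
      sub_add_cancel]
  have hscar' : ∀ᶠ n in atTop, ∀ Φ ∈ scarSpace u ψ (n + 1), hamiltonian (n + 1) h' *ᵥ Φ = 0 := by
    filter_upwards [shift] with n ⟨hn, shift⟩ Φ hΦ
    rw [eq_sub_of_add_eq shift.symm, Matrix.sub_mulVec, hscar (n + 1) hn Φ hΦ, Matrix.smul_mulVec,
      Matrix.one_mulVec, sub_self]
  have first := re_mem_momentumBands (expectation_hamiltonian_mem_momentumBands hψ hscar' hq)
  have second := re_mem_momentumBands (expectation_hamiltonian_sq_mem_momentumBands hψ hscar' hq)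
  refine ⟨_, first, _, sub_mem second (mul_mem first first), ?_⟩
  filter_upwards [shift] with n ⟨_, shift⟩ w p
  rw [twistedState_eq_modeState rfl]
  exact fun hne => ⟨energy_sub_eq shift hne, energyVariance_eq shift hne⟩

theorem exists_forall_of_eventually_succ {P : ∀ (N : ℕ) [NeZero N], Prop}
    (h : ∀ᶠ n in atTop, P (n + 1)) : ∃ N₀ : ℕ, ∀ (N : ℕ) [NeZero N], N₀ ≤ N → P N := by
  obtain ⟨n₀, h⟩ := eventually_atTop.mp h
  refine ⟨n₀ + 1, fun N _ hN => ?_⟩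
  obtain ⟨n, rfl⟩ := Nat.exists_eq_add_of_le' (Nat.one_le_of_lt hN)
  exact h n (by omega)

end Asymptotics

end ScarTower

open Filter ScarTower in
theorem mainTheorem6_general {d m : ℕ} {G : Type*} [Group G]
    (u : G →* Matrix.unitaryGroup (Fin d) ℂ) (ψ : Fin d → ℂ) (hψ : star ψ ⬝ᵥ ψ = 1)
    (h : Matrix (Fin (m + 1) → Fin d) (Fin (m + 1) → Fin d) ℂ) (N₁ : ℕ) (E₀ : ℕ → ℝ)
    (hscar : ∀ (N : ℕ) [NeZero N], N₁ ≤ N → ∀ Ψ ∈ scarSpace u ψ N,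
      hamiltonian N h *ᵥ Ψ = (E₀ N : ℂ) • Ψ)
    (q : Matrix (Fin d) (Fin d) ℂ) (hq : q ∈ complexGenerators u) :
    (∀ w : List (Matrix (Fin d) (Fin d) ℂ), (∀ a ∈ w, a ∈ complexGenerators u) →
      ∃ ε v : ℝ → ℝ, Continuous ε ∧ Continuous v ∧
        Tendsto ε (nhds 0) (nhds 0) ∧ Tendsto v (nhds 0) (nhds 0) ∧
        ∀ η > 0, ∃ N₀ : ℕ, ∀ (N : ℕ) [NeZero N], N₀ ≤ N → ∀ (p : ℤ) (k : ℝ),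
          k = 2 * Real.pi * p / N → ¬ (N : ℤ) ∣ p → twistedState N ψ w q k ≠ 0 →
          |energy N (hamiltonian N h) (twistedState N ψ w q k) - E₀ N - ε k| < η ∧
          |energyVariance N (hamiltonian N h) (twistedState N ψ w q k) - v k| < η) ∧
    (∀ η > 0, ∃ δ > 0, ∃ N₀ : ℕ, ∀ (N : ℕ) [NeZero N], N₀ ≤ N →
      ∀ w : List (Matrix (Fin d) (Fin d) ℂ), (∀ a ∈ w, a ∈ complexGenerators u) →
      ∀ (p : ℤ) (k : ℝ), k = 2 * Real.pi * p / N → ¬ (N : ℤ) ∣ p → twistedState N ψ w q k ≠ 0 →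
        (∀ (p' : ℤ) (k' : ℝ), k' = 2 * Real.pi * p' / N → ¬ (N : ℤ) ∣ p' →
          twistedState N ψ w q k' ≠ 0 → |k - k'| < δ →
          |energy N (hamiltonian N h) (twistedState N ψ w q k) -
            energy N (hamiltonian N h) (twistedState N ψ w q k')| < η ∧
          |energyVariance N (hamiltonian N h) (twistedState N ψ w q k) -
            energyVariance N (hamiltonian N h) (twistedState N ψ w q k')| < η) ∧
        (|k| < δ →
          |energy N (hamiltonian N h) (twistedState N ψ w q k) - E₀ N| < η ∧
          |energyVariance N (hamiltonian N h) (twistedState N ψ w q k)| < η)) := by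
  obtain ⟨x, hx, y, hy, bands⟩ := exists_energy_bands hψ hscar hq
  refine ⟨fun w hw => ?_, fun η hη => ?_⟩
  · obtain ⟨ε, hε, hε₀, energy_limit⟩ := exists_limit_of_mem_momentumBands hx ⟨w, hw⟩
    obtain ⟨v, hv, hv₀, variance_limit⟩ := exists_limit_of_mem_momentumBands hy ⟨w, hw⟩
    refine ⟨ε, v, hε, hv, hε₀, hv₀, fun η hη => exists_forall_of_eventually_succ ?_⟩
    filter_upwards [bands, energy_limit η hη, variance_limit η hη] with n bands hlim hlim'
    rintro p _ rfl hp hne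
    obtain ⟨hE, hV⟩ := bands ⟨w, hw⟩ p hne
    exact ⟨hE ▸ hlim p hp, hV ▸ hlim' p hp⟩
  · obtain ⟨δ, hδ, energy_modulus⟩ := exists_modulus_of_mem_momentumBands hx hη
    obtain ⟨δ', hδ', variance_modulus⟩ := exists_modulus_of_mem_momentumBands hy hη
    refine ⟨min δ δ', lt_min hδ hδ', exists_forall_of_eventually_succ ?_⟩
    filter_upwards [bands, energy_modulus, variance_modulus] with n bands hmod hmod' w hw
    rintro p _ rfl hp hne
    obtain ⟨hE, hV⟩ := bands ⟨w, hw⟩ p hne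
    obtain ⟨near, small⟩ := hmod ⟨w, hw⟩ p hp
    obtain ⟨near', small'⟩ := hmod' ⟨w, hw⟩ p hp
    refine ⟨?_, fun hk => ?_⟩
    · rintro p' _ rfl hp' hne' hk
      obtain ⟨hE', hV'⟩ := bands ⟨w, hw⟩ p' hne'
      rw [← sub_sub_sub_cancel_right _ _ (E₀ (n + 1)), hE, hE', hV, hV']
      exact ⟨near p' hp' (hk.trans_le (min_le_left _ _)),
        near' p' hp' (hk.trans_le (min_le_right _ _))⟩
    · rw [hE, hV]
      exact ⟨small (hk.trans_le (min_le_left _ _)), small' (hk.trans_le (min_le_right _ _))⟩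

theorem mainTheorem6 {d m : ℕ} {G : Type*} [Group G]
    -- the onsite unitary action of the quasisymmetry group
    (u : G →* Matrix.unitaryGroup (Fin d) ℂ)
    -- Cartan subalgebra, choice of positive roots, and local anchor state
    (T : Submodule ℝ (Matrix (Fin d) (Fin d) ℂ)) (hT : ScarTower.IsCartan u T)
    (z : T) (hz : ScarTower.IsRegular u T z)
    (ψ : Fin d → ℂ) (hψ : ScarTower.IsAnchor u T z ψ)
    -- the local term, and degeneracy of the Hamiltonian on the quasisymmetry subspace
    (h : Matrix (Fin (m + 1) → Fin d) (Fin (m + 1) → Fin d) ℂ) (hh : h.IsHermitian)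
    (N₁ : ℕ) (E₀ : ℕ → ℝ)
    (hscar : ∀ (N : ℕ) [NeZero N], N₁ ≤ N → ∀ Ψ ∈ ScarTower.scarSpace u ψ N,
      ScarTower.hamiltonian N h *ᵥ Ψ = (E₀ N : ℂ) • Ψ)
    -- the ladder operator that creates the mode
    (q : Matrix (Fin d) (Fin d) ℂ) (hq : ScarTower.IsRaising u T z q) :
    -- a fixed tower label: the thermodynamic limits exist, are continuous in `k`, and vanish
    -- as `k → 0`; the finite-size quantities converge to them uniformly in the momentum
    (∀ w : List (Matrix (Fin d) (Fin d) ℂ), (∀ a ∈ w, ScarTower.IsRaising u T z a) →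
      ∃ ε v : ℝ → ℝ, Continuous ε ∧ Continuous v ∧
        Filter.Tendsto ε (nhds 0) (nhds 0) ∧ Filter.Tendsto v (nhds 0) (nhds 0) ∧
        ∀ η > 0, ∃ N₀ : ℕ, ∀ (N : ℕ) [NeZero N], N₀ ≤ N → ∀ (p : ℤ) (k : ℝ),
          k = 2 * Real.pi * p / N → ¬ (N : ℤ) ∣ p →
          ScarTower.twistedState N ψ w q k ≠ 0 →
          |ScarTower.energy N (ScarTower.hamiltonian N h) (ScarTower.twistedState N ψ w q k)
              - E₀ N - ε k| < η ∧
          |ScarTower.energyVariance N (ScarTower.hamiltonian N h)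
              (ScarTower.twistedState N ψ w q k) - v k| < η) ∧
    -- arbitrary tower states, whose label may depend on the size (finite filling included):
    -- energy and variance are continuous in `k`, and small for small `k`, uniformly in the tower
    -- state and in the size
    (∀ η > 0, ∃ δ > 0, ∃ N₀ : ℕ, ∀ (N : ℕ) [NeZero N], N₀ ≤ N →
      ∀ w : List (Matrix (Fin d) (Fin d) ℂ), (∀ a ∈ w, ScarTower.IsRaising u T z a) →
      ∀ (p : ℤ) (k : ℝ), k = 2 * Real.pi * p / N → ¬ (N : ℤ) ∣ p →
        ScarTower.twistedState N ψ w q k ≠ 0 →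
        (∀ (p' : ℤ) (k' : ℝ), k' = 2 * Real.pi * p' / N → ¬ (N : ℤ) ∣ p' →
          ScarTower.twistedState N ψ w q k' ≠ 0 → |k - k'| < δ →
          |ScarTower.energy N (ScarTower.hamiltonian N h) (ScarTower.twistedState N ψ w q k)
              - ScarTower.energy N (ScarTower.hamiltonian N h)
                  (ScarTower.twistedState N ψ w q k')| < η ∧
          |ScarTower.energyVariance N (ScarTower.hamiltonian N h)
                (ScarTower.twistedState N ψ w q k)
              - ScarTower.energyVariance N (ScarTower.hamiltonian N h)
                  (ScarTower.twistedState N ψ w q k')| < η) ∧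
        (|k| < δ →
          |ScarTower.energy N (ScarTower.hamiltonian N h) (ScarTower.twistedState N ψ w q k)
              - E₀ N| < η ∧
          |ScarTower.energyVariance N (ScarTower.hamiltonian N h)
              (ScarTower.twistedState N ψ w q k)| < η)) := by
  have mem : ∀ a, ScarTower.IsRaising u T z a → a ∈ ScarTower.complexGenerators u :=
    fun _ ⟨_, root, _⟩ => root.mem
  obtain ⟨fixed, uniform⟩ :=
    mainTheorem6_general u ψ hψ.normalized h N₁ E₀ hscar q (mem q hq)
  refine ⟨fun w hw => fixed w fun a ha => mem a (hw a ha), fun η hη => ?_⟩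
  obtain ⟨δ, hδ, N₀, bounds⟩ := uniform η hη
  exact ⟨δ, hδ, N₀, fun N _ hN w hw => bounds N hN w fun a ha => mem a (hw a ha)⟩
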